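/- Work with finite binary strings $\{0,1\}^*$. A computer is a partial recursive function $C\colon\{0,1\}^*\to\{0,1\}^*$ whose domain is prefix-free; a computer $U$ is optimal if for every computer $C$ there is a constant $\mathrm{sim}(C)$ such that whenever $C(p)$ is defined there is $p'$ with $U(p')=C(p)$ and $|p'|\le|p|+\mathrm{sim}(C)$. Fix any optimal computer $U$, let $H(s)=\min\{|p| : U(p)=s\}$, and let $q_1,q_2,\dots$ be any enumeration without repetition (not necessarily recursive) of the infinite set $\operatorname{Dom}U$. For real $T>0$ and $n\ge1$ put $$Z_n(T)=\sum_{i=1}^n 2^{-|q_i|/T},\qquad F_n(T)=-T\log_2 Z_n(T),$$ and let the free energy be $F(T)=\lim_{n\to\infty}F_n(T)$. A real $x$ is computable if there is a total recursive $f\colon\mathbb N^+\to\mathbb Q$ with $|x-f(n)|<1/n$ for all $n\ge 1$, and right-computable if there is a total recursive $g\colon\mathbb N^+\to\mathbb Q$ with $x\le g(n)$ for all $n\ge 1$ and $\lim_{n\to\infty}g(n)=x$. Let $x_n$ denote the first $n$ bits of the binary expansion of $x-\lfloor x\rfloor$ with infinitely many zeros. For $D\ge0$, $x$ is weakly Chaitin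 $D$-random if there is $c\in\mathbb R$ with $Dn-c\le H(x_n)$ for all $n\ge1$, and $D$-compressible if $H(x_n)\le Dn+o(n)$. **Theorem.** Let $T\in\mathbb R$. 1. If $0<T\le1$ and $T$ is computable, then $F_n(T)$ converges as $n\to\infty$ to a real number $F(T)$ that is right-computable, weakly Chaitin $T$-random and $T$-compressible. 2. If $T>1$, then $F_n(T)$ diverges to $-\infty$ as $n\to\infty$. -/

import Mathlib

open Filter Topology Asymptotics

/-- A computer: a partial recursive function on finite binary strings whose domain is a
prefix-free set. -/
structure IsComputer (C : List Bool →. List Bool) : Prop where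
  partrec : Partrec C
  prefixFree : ∀ p ∈ C.Dom, ∀ q ∈ C.Dom, p <+: q → p = q

/-- An optimal computer: it simulates every computer up to an additive constant in
program length. -/
structure IsOptimalComputer (U : List Bool →. List Bool) : Prop where
  isComputer : IsComputer U
  simulates : ∀ C : List Bool →. List Bool, IsComputer C →
    ∃ sim : ℕ, ∀ p s : List Bool, s ∈ C p →
      ∃ p' : List Bool, s ∈ U p' ∧ p'.length ≤ p.length + sim

/-- Program-size complexity `H_U(s)`: the least length of a program `p` with `U(p) = s`.
For an optimal `U` every string has a program, so the set is nonempty. -/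
noncomputable def programSize (U : List Bool →. List Bool) (s : List Bool) : ℕ :=
  sInf {k : ℕ | ∃ p : List Bool, s ∈ U p ∧ p.length = k}

/-- The infinite binary string `α` such that `0.α` is the base-two expansion of
`x mod 1 = x - ⌊x⌋` with infinitely many zeros. The digit with index `i`
(counting from `0`) has weight `2^{-(i+1)}`. -/
noncomputable def binaryExpansion (x : ℝ) : ℕ → Bool :=
  fun i => decide (⌊Int.fract x * 2 ^ (i + 1)⌋ % 2 = 1)

/-- The prefix of length `n` of an infinite binary string. -/
def binaryPrefix (α : ℕ → Bool) (n : ℕ) : List Bool :=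
  (List.range n).map α

/-- A sequence of rationals is total recursive: numerators (as differences of natural numbers)
and positive denominators are given by computable functions. -/
def IsRecursiveRatSeq (f : ℕ → ℚ) : Prop :=
  ∃ a b c : ℕ → ℕ, Computable a ∧ Computable b ∧ Computable c ∧
    ∀ n, f n = ((a n : ℚ) - (b n : ℚ)) / ((c n : ℚ) + 1)

/-- Computable real numbers. (The value of the sequence at `0` plays no role.) -/
def IsComputableReal (x : ℝ) : Prop :=
  ∃ f : ℕ → ℚ, IsRecursiveRatSeq f ∧ ∀ n : ℕ, 1 ≤ n → |x - (f n : ℝ)| < 1 / (n : ℝ)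

/-- Right-computable real numbers: limits from above of recursive sequences of rationals. -/
def IsRightComputableReal (x : ℝ) : Prop :=
  ∃ g : ℕ → ℚ, IsRecursiveRatSeq g ∧ (∀ n : ℕ, 1 ≤ n → x ≤ (g n : ℝ)) ∧
    Tendsto (fun n => (g n : ℝ)) atTop (𝓝 x)

/-- Weak Chaitin `D`-randomness of an infinite binary string (complexity taken with
respect to `U`). -/
def WeaklyChaitinRandom (U : List Bool →. List Bool) (D : ℝ) (α : ℕ → Bool) : Prop :=
  ∃ c : ℝ, ∀ n : ℕ, 1 ≤ n → D * n - c ≤ (programSize U (binaryPrefix α n) : ℝ)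

/-- `D`-compressibility: `H(α_n) ≤ D n + o(n)`. -/
def Compressible (U : List Bool →. List Bool) (D : ℝ) (α : ℕ → Bool) : Prop :=
  ∃ e : ℕ → ℝ, e =o[atTop] (fun n : ℕ => (n : ℝ)) ∧
    ∀ n : ℕ, 1 ≤ n → (programSize U (binaryPrefix α n) : ℝ) ≤ D * n + e n

/-- `q` enumerates the domain of `U` without repetition (the enumeration need not be
recursive). -/
def EnumeratesDomain (q : ℕ → List Bool) (U : List Bool →. List Bool) : Prop :=
  Function.Injective q ∧ Set.range q = U.Dom

/-- `Z_n(T)`: the partial sum of `2^{-|q_i|/T}` over the first `n` elements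
`q 0, …, q (n - 1)` of the enumeration. -/
noncomputable def partialPartitionFunction (q : ℕ → List Bool) (T : ℝ) (n : ℕ) : ℝ :=
  ∑ i ∈ Finset.range n, (2 : ℝ) ^ (-((q i).length : ℝ) / T)

/-- `F_n(T) = -T log₂ Z_n(T)` (of interest for `n ≥ 1`, where `Z_n(T) > 0`).
The free energy `F(T)` is the limit of `F_n(T)` as `n → ∞`. -/
noncomputable def partialFreeEnergy (q : ℕ → List Bool) (T : ℝ) (n : ℕ) : ℝ :=
  -T * Real.logb 2 (partialPartitionFunction q T n)

/-! Put `β = 2 ^ (-1 / T)` and `Z = ∑ β ^ |p|` over `p ∈ Dom U`, so that `F(T)` is the logarithm of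
`Z` to base `β`. For `T ≤ 1` one has `β ≤ 1/2`, and Kraft's inequality makes `Z` finite and
independent of the enumeration. Let `Z_k` sum over the programs seen to halt by stage `k`. As `Z_k`
increases to `Z` and `β < 1`, the logarithms `F_k` of `Z_k` decrease to `F`; they are uniformly
computable because `β` is (`exists_computable_logb_stageSum`), which gives right-computability.

Randomness (`weaklyChaitinRandom_logb_partitionSum`): `n` bits of `F` suffice to find a stage with
`F_k < F + 2^{-n}`, hence `Z - Z_k ≤ 2^{-n} / T`. A program outside that stage weighs at most this,
so its length is at least `T n - O(1)`. A string not output by stage `k` has only such programs, yet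
is computable from the bits of `F`.

Compressibility (`compressible_logb_partitionSum`): about `T n` bits of `Ω`, the value of `Z` at `β
= 1/2`, yield a stage after which the tail of `Ω` is at most `2^{-Tn}`. Since `1 / T ≥ 1`, the tail
of `Z` is then at most `2^{-n}` (`partitionSum_le_stageSum_add`), and `F_k` determines the first `n`
bits of `F` up to a bounded correction. Self-delimiting overhead is only `O(√n)`
(`exists_program_length_le`).

For `T > 1`, the `2^l` strings of length `l` have programs of length `l + O(√l)`, and their total
weight is unbounded. -/

theorem primrec₂_nat_pow : Primrec₂ ((· ^ ·) : ℕ → ℕ → ℕ) :=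
  Primrec₂.unpaired'.1 Nat.Primrec.pow

theorem computable₂_nat_pow : Computable₂ ((· ^ ·) : ℕ → ℕ → ℕ) := primrec₂_nat_pow.to_comp

/-! ### Closure of computable functions under arithmetic -/

section
variable {α : Type*} [Primcodable α]

theorem Computable.nat_add {f g : α → ℕ} (hf : Computable f) (hg : Computable g) :
    Computable fun a => f a + g a := Primrec.nat_add.to_comp.comp hf hg

theorem Computable.nat_mul {f g : α → ℕ} (hf : Computable f) (hg : Computable g) :
    Computable fun a => f a * g a := Primrec.nat_mul.to_comp.comp hf hg

theorem Computable.nat_sub {f g : α → ℕ} (hf : Computable f) (hg : Computable g) :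
    Computable fun a => f a - g a := Primrec.nat_sub.to_comp.comp hf hg

theorem Computable.nat_div {f g : α → ℕ} (hf : Computable f) (hg : Computable g) :
    Computable fun a => f a / g a := Primrec.nat_div.to_comp.comp hf hg

theorem Computable.nat_mod {f g : α → ℕ} (hf : Computable f) (hg : Computable g) :
    Computable fun a => f a % g a := Primrec.nat_mod.to_comp.comp hf hg

theorem Computable.nat_pow {f g : α → ℕ} (hf : Computable f) (hg : Computable g) :
    Computable fun a => f a ^ g a := computable₂_nat_pow.comp hf hg

theorem Computable.nat_lt {f g : α → ℕ} (hf : Computable f) (hg : Computable g) :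
    Computable fun a => decide (f a < g a) :=
  (Primrec.nat_lt.decide).to_comp.comp hf hg

theorem Computable.nat_le {f g : α → ℕ} (hf : Computable f) (hg : Computable g) :
    Computable fun a => decide (f a ≤ g a) :=
  (Primrec.nat_le.decide).to_comp.comp hf hg

theorem Computable.nat_eq {f g : α → ℕ} (hf : Computable f) (hg : Computable g) :
    Computable fun a => decide (f a = g a) :=
  (Primrec.eq (α := ℕ).decide).to_comp.comp hf hg

theorem Computable.finset_sum_range {g : α → ℕ} {f : α → ℕ → ℕ} (hg : Computable g)
    (hf : Computable₂ f) : Computable fun a => ∑ i ∈ Finset.range (g a), f a i := by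
  refine (Computable.nat_rec (f := g) (g := fun _ => 0)
    (h := fun a (p : ℕ × ℕ) => p.2 + f a p.1) hg (Computable.const 0) ?_).of_eq fun a => ?_
  · exact Computable.nat_add (Computable.snd.comp Computable.snd)
      (hf.comp Computable.fst (Computable.fst.comp Computable.snd))
  · induction g a with
    | zero => rfl
    | succ n ih => rw [Finset.sum_range_succ, ← ih]

theorem Computable.bool_and {f g : α → Bool} (hf : Computable f) (hg : Computable g) :
    Computable fun a => f a && g a := Primrec.and.to_comp.comp hf hg

end

/-! ### Stages of an enumeration -/

open Nat.Partrec (Code)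

/-- The length of the binary string with code `i`, as a number that is at most `i`. -/
def codeLength (i : ℕ) : ℕ := min ((Encodable.decode (α := List Bool) i).getD []).length i

theorem codeLength_le (i : ℕ) : codeLength i ≤ i := min_le_right _ _

theorem codeLength_encode (p : List Bool) : codeLength (Encodable.encode p) = p.length := by
  simp [codeLength, Encodable.length_le_encode p]

theorem computable_codeLength : Computable codeLength :=
  Primrec.nat_min.to_comp.comp (Computable.list_length.comp
    (Primrec.option_getD.to_comp.comp Computable.decode (Computable.const []))) Computable.id

/-- The code `c` halts on input `i` within `k` steps. -/
def haltsBy (c : Code) (k i : ℕ) : Bool := (Code.evaln k c i).isSome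

theorem computable_evaln (c : Code) : Computable₂ fun k i => Code.evaln k c i :=
  (Code.primrec_evaln.comp (Primrec.pair (Primrec.pair Primrec.fst (Primrec.const c))
    Primrec.snd)).to_comp

theorem computable_haltsBy (c : Code) : Computable₂ (haltsBy c) :=
  Primrec.option_isSome.to_comp.comp (computable_evaln c)

theorem haltsBy_mono {c : Code} {k₁ k₂ i : ℕ} (h : k₁ ≤ k₂) (hi : haltsBy c k₁ i = true) :
    haltsBy c k₂ i = true := by
  obtain ⟨x, hx⟩ := Option.isSome_iff_exists.1 hi
  exact Option.isSome_iff_exists.2 ⟨x, Code.evaln_mono h hx⟩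

theorem lt_of_haltsBy {c : Code} {k i : ℕ} (hi : haltsBy c k i = true) : i < k := by
  obtain ⟨x, hx⟩ := Option.isSome_iff_exists.1 hi
  exact Code.evaln_bound hx

theorem dom_of_haltsBy {c : Code} {k i : ℕ} (hi : haltsBy c k i = true) : (c.eval i).Dom := by
  obtain ⟨x, hx⟩ := Option.isSome_iff_exists.1 hi
  exact Part.dom_iff_mem.2 ⟨x, Code.evaln_sound hx⟩

theorem exists_haltsBy {c : Code} {i : ℕ} (hi : (c.eval i).Dom) : ∃ k, haltsBy c k i = true := by
  obtain ⟨x, hx⟩ := Part.dom_iff_mem.1 hi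
  obtain ⟨k, hk⟩ := Code.evaln_complete.1 hx
  exact ⟨k, Option.isSome_iff_exists.2 ⟨x, hk⟩⟩

/-- The partition function of the programs that halt by stage `k`, at inverse-temperature
weight `β` per bit. -/
noncomputable def stageSum (c : Code) (β : ℝ) (k : ℕ) : ℝ :=
  ∑ i ∈ Finset.range k, if haltsBy c k i then β ^ codeLength i else 0

/-- The numerator of `stageSum c (u / v) k` over the denominator `v ^ k`. -/
def stageNum (c : Code) (k u v : ℕ) : ℕ :=
  ∑ i ∈ Finset.range k, bif haltsBy c k i then u ^ codeLength i * v ^ (k - codeLength i) else 0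

theorem stageSum_eq_stageNum_div (c : Code) (k u v : ℕ) (hv : v ≠ 0) :
    stageSum c ((u : ℝ) / v) k = (stageNum c k u v : ℝ) / (v : ℝ) ^ k := by
  have hv' : (v : ℝ) ≠ 0 := by exact_mod_cast hv
  rw [stageNum, stageSum, Nat.cast_sum, Finset.sum_div]
  refine Finset.sum_congr rfl fun i hi => ?_
  have hik : codeLength i ≤ k := (codeLength_le i).trans (Finset.mem_range.1 hi).le
  cases haltsBy c k i
  · simp
  · simp only [if_true, cond_true, Nat.cast_mul, Nat.cast_pow]
    rw [div_pow, div_eq_div_iff (pow_ne_zero _ hv') (pow_ne_zero _ hv'), mul_assoc, ← pow_add,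
      Nat.sub_add_cancel hik]

theorem computable_stageNum {α : Type*} [Primcodable α] (c : Code) {k u v : α → ℕ}
    (hk : Computable k) (hu : Computable u) (hv : Computable v) :
    Computable fun a => stageNum c (k a) (u a) (v a) := by
  have hl : Computable fun p : α × ℕ => codeLength p.2 :=
    computable_codeLength.comp Computable.snd
  refine Computable.finset_sum_range hk (Computable.cond
    ((computable_haltsBy c).comp (hk.comp Computable.fst) Computable.snd)
    (Computable.nat_mul (Computable.nat_pow (hu.comp Computable.fst) hl)
      (Computable.nat_pow (hv.comp Computable.fst)
        (Computable.nat_sub (hk.comp Computable.fst) hl)))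
    (Computable.const 0))

theorem continuous_stageSum (c : Code) (k : ℕ) : Continuous fun β => stageSum c β k := by
  unfold stageSum
  refine continuous_finsetSum _ fun i _ => ?_
  split_ifs <;> fun_prop

theorem stageSum_le_stageSum {c : Code} {β γ : ℝ} (h0 : 0 ≤ β) (h : β ≤ γ) (k : ℕ) :
    stageSum c β k ≤ stageSum c γ k := by
  refine Finset.sum_le_sum fun i _ => ?_
  split_ifs
  · gcongr
  · exact le_rfl

/-! ### Fixed-width binary representations -/

/-- The `n` low binary digits of `x`, most significant first. -/
def lowBits (n x : ℕ) : List Bool :=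
  (List.range n).map fun i => decide (x / 2 ^ (n - 1 - i) % 2 = 1)

/-- The number with given binary digits, most significant first. -/
def bitsValue (w : List Bool) : ℕ := w.foldl (fun x b => 2 * x + b.toNat) 0

@[simp] theorem length_lowBits (n x : ℕ) : (lowBits n x).length = n := by simp [lowBits]

theorem lowBits_succ (n x : ℕ) : lowBits (n + 1) x = lowBits n (x / 2) ++ [decide (x % 2 = 1)] := by
  rw [lowBits, lowBits, List.range_succ, List.map_append]
  congr 1
  · refine List.map_congr_left fun i hi => ?_
    have : n + 1 - 1 - i = (n - 1 - i) + 1 := by have := List.mem_range.1 hi; omega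
    rw [this, pow_succ', Nat.div_div_eq_div_mul]
  · simp

theorem bitsValue_lowBits {n x : ℕ} (hx : x < 2 ^ n) : bitsValue (lowBits n x) = x := by
  induction n generalizing x with
  | zero => simp at hx; simp [hx, lowBits, bitsValue]
  | succ n ih =>
    have h2 : bitsValue (lowBits n (x / 2)) = x / 2 := ih (by rw [pow_succ] at hx; omega)
    rw [bitsValue] at h2 ⊢
    rw [lowBits_succ, List.foldl_append, h2]
    rcases Nat.mod_two_eq_zero_or_one x with h | h <;> simp [h] <;> omega

theorem lowBits_mod (n x : ℕ) : lowBits n (x % 2 ^ n) = lowBits n x := by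
  refine List.map_congr_left fun i hi => ?_
  have : n = (n - 1 - i) + (i + 1) := by have := List.mem_range.1 hi; omega
  conv_lhs => rw [this]
  have e : n - 1 - i + (i + 1) - 1 - i = n - 1 - i := by omega
  rw [e, pow_add, Nat.mod_mul_right_div_self, pow_succ', Nat.mod_mul_right_mod]

theorem computable_bitsValue : Computable bitsValue := by
  have : Primrec bitsValue := by
    refine Primrec.list_foldl (h := fun (_ : List Bool) (p : ℕ × Bool) => 2 * p.1 + p.2.toNat)
      Primrec.id (Primrec.const 0) ?_
    refine Primrec.nat_add.comp (Primrec.nat_mul.comp (Primrec.const 2)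
      (Primrec.fst.comp Primrec.snd)) ?_
    exact (Primrec.dom_bool Bool.toNat).comp (Primrec.snd.comp Primrec.snd)
  exact this.to_comp

theorem computable_lowBits : Computable₂ lowBits := by
  have : Primrec₂ lowBits := by
    refine Primrec.list_map (Primrec.list_range.comp Primrec.fst) ?_
    have hx : Primrec fun p : (ℕ × ℕ) × ℕ => p.1.2 / 2 ^ (p.1.1 - 1 - p.2) % 2 :=
      Primrec.nat_mod.comp (Primrec.nat_div.comp (Primrec.snd.comp Primrec.fst)
        (primrec₂_nat_pow.comp (Primrec.const 2) (Primrec.nat_sub.comp (Primrec.nat_sub.comp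
          (Primrec.fst.comp Primrec.fst) (Primrec.const 1)) Primrec.snd))) (Primrec.const 2)
    exact (Primrec.eq (α := ℕ).decide).comp hx (Primrec.const 1)
  exact this.to_comp

/-! ### Rational roots of powers of two -/

/-- The largest `u ≤ 2 ^ j` with `(u / 2 ^ j) ^ A ≤ 2 ^ (-B)`. -/
def dyadicRoot (A B j : ℕ) : ℕ := Nat.findGreatest (fun u => u ^ A * 2 ^ B ≤ 2 ^ (j * A)) (2 ^ j)

theorem computable_dyadicRoot {α : Type*} [Primcodable α] {A B j : α → ℕ} (hA : Computable A)
    (hB : Computable B) (hj : Computable j) : Computable fun a => dyadicRoot (A a) (B a) (j a) := by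
  have : Primrec fun p : ℕ × ℕ × ℕ => dyadicRoot p.1 p.2.1 p.2.2 := by
    refine Primrec.nat_findGreatest (p := fun (p : ℕ × ℕ × ℕ) u =>
      u ^ p.1 * 2 ^ p.2.1 ≤ 2 ^ (p.2.2 * p.1)) (primrec₂_nat_pow.comp (Primrec.const 2)
      (Primrec.snd.comp Primrec.snd)) ?_
    have h1 : Primrec fun q : (ℕ × ℕ × ℕ) × ℕ => q.1.1 := Primrec.fst.comp Primrec.fst
    have h2 : Primrec fun q : (ℕ × ℕ × ℕ) × ℕ => q.1.2.1 :=
      Primrec.fst.comp (Primrec.snd.comp Primrec.fst)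
    have h3 : Primrec fun q : (ℕ × ℕ × ℕ) × ℕ => q.1.2.2 :=
      Primrec.snd.comp (Primrec.snd.comp Primrec.fst)
    exact Primrec.nat_le.comp
      (Primrec.nat_mul.comp (primrec₂_nat_pow.comp Primrec.snd h1)
        (primrec₂_nat_pow.comp (Primrec.const 2) h2))
      (primrec₂_nat_pow.comp (Primrec.const 2) (Primrec.nat_mul.comp h3 h1))
  exact this.to_comp.comp (hA.pair (hB.pair hj))

/-- The root is the positive solution of `x ^ A * 2 ^ B = 1`, so comparing a dyadic rational with it
is the integer inequality in `dyadicRoot`. -/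
theorem two_rpow_neg_div_pow {A : ℕ} (hA : A ≠ 0) (B : ℕ) :
    ((2 : ℝ) ^ (-(B : ℝ) / A)) ^ A * 2 ^ B = 1 := by
  have hA' : (A : ℝ) ≠ 0 := by exact_mod_cast hA
  rw [← Real.rpow_mul_natCast (by norm_num), div_mul_cancel₀ _ hA', ← Real.rpow_natCast,
    ← Real.rpow_add (by norm_num)]
  simp

theorem dyadicRoot_le {A B j : ℕ} (hA : A ≠ 0) :
    (dyadicRoot A B j : ℝ) / 2 ^ j ≤ (2 : ℝ) ^ (-(B : ℝ) / A) := by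
  have h : dyadicRoot A B j ^ A * 2 ^ B ≤ 2 ^ (j * A) :=
    Nat.findGreatest_spec (P := fun u => u ^ A * 2 ^ B ≤ 2 ^ (j * A)) (Nat.zero_le _)
      (by simp [hA])
  have h' : (dyadicRoot A B j : ℝ) ^ A * 2 ^ B ≤ 2 ^ (j * A) := by exact_mod_cast h
  refine (pow_le_pow_iff_left₀ (by positivity) (by positivity) hA).1 ?_
  have h1 := two_rpow_neg_div_pow hA B
  rw [div_pow, ← pow_mul, div_le_iff₀ (by positivity)]
  refine le_of_mul_le_mul_right ?_ (show (0 : ℝ) < 2 ^ B by positivity)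
  calc _ ≤ _ := h'
    _ = (((2 : ℝ) ^ (-(B : ℝ) / A)) ^ A * 2 ^ B) * 2 ^ (j * A) := by rw [h1, one_mul]
    _ = _ := by ring

theorem le_dyadicRoot_add_one {A B j : ℕ} (hA : A ≠ 0) :
    (2 : ℝ) ^ (-(B : ℝ) / A) ≤ ((dyadicRoot A B j : ℝ) + 1) / 2 ^ j := by
  -- If the search ends at its bound `2 ^ j`, the successor was never tested; the root being at most
  -- 1 then suffices.
  rcases lt_or_ge (dyadicRoot A B j) (2 ^ j) with hlt | hge
  · have h : ¬ ((dyadicRoot A B j + 1) ^ A * 2 ^ B ≤ 2 ^ (j * A)) :=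
      Nat.findGreatest_is_greatest (P := fun u => u ^ A * 2 ^ B ≤ 2 ^ (j * A))
        (Nat.lt_succ_self _) hlt
    have h' : (2 : ℝ) ^ (j * A) ≤ ((dyadicRoot A B j : ℝ) + 1) ^ A * 2 ^ B := by
      exact_mod_cast (not_le.1 h).le
    refine (pow_le_pow_iff_left₀ (by positivity) (by positivity) hA).1 ?_
    have h1 := two_rpow_neg_div_pow hA B
    rw [div_pow, ← pow_mul, le_div_iff₀ (by positivity)]
    refine le_of_mul_le_mul_right ?_ (show (0 : ℝ) < 2 ^ B by positivity)
    calc _ = (((2 : ℝ) ^ (-(B : ℝ) / A)) ^ A * 2 ^ B) * 2 ^ (j * A) := by ring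
      _ = 2 ^ (j * A) := by rw [h1, one_mul]
      _ ≤ _ := h'
  · have h2 : (2 : ℝ) ^ j ≤ dyadicRoot A B j := by exact_mod_cast hge
    calc (2 : ℝ) ^ (-(B : ℝ) / A) ≤ 1 :=
          Real.rpow_le_one_of_one_le_of_nonpos (by norm_num)
            (div_nonpos_of_nonpos_of_nonneg (by simp) (by positivity))
      _ ≤ _ := by rw [le_div_iff₀ (by positivity)]; linarith

/-- A truncated lower approximation of `T` may have numerator 0; the search then falls back on its
default 0, still a lower bound. -/
theorem dyadicRoot_zero_left {B j : ℕ} (hB : B ≠ 0) : dyadicRoot 0 B j = 0 := by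
  refine Nat.findGreatest_eq_zero_iff.2 fun n _ _ => ?_
  simp [hB]

/-- Rational approximations `A / B` of a computable real, from below and from above. -/
theorem IsComputableReal.exists_nat_bounds {T : ℝ} (hT : 0 < T) (h : IsComputableReal T) :
    ∃ A A' B : ℕ → ℕ, Computable A ∧ Computable A' ∧ Computable B ∧ (∀ j, B j ≠ 0) ∧
      (∀ j, (A j : ℝ) / B j ≤ T) ∧ (∀ j, T ≤ (A' j : ℝ) / B j) ∧
      (∀ j, (A' j : ℝ) / B j ≤ (A j : ℝ) / B j + 2 / (j + 1)) := by
  obtain ⟨f, ⟨a, b, d, ha, hb, hd, hf⟩, hfT⟩ := h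
  have hs : Computable fun j : ℕ => j + 1 := Computable.succ
  -- The estimate on `f (j + 1)` with denominators cleared; the shift avoids the unconstrained value
  -- `f 0`.
  have key : ∀ j : ℕ, |T * (d (j + 1) + 1) * (j + 1) - (a (j + 1) - b (j + 1)) * (j + 1)|
      < d (j + 1) + 1 := by
    intro j
    have h1 := hfT (j + 1) (by omega)
    rw [hf] at h1
    push_cast at h1
    have hd0 : (0 : ℝ) < d (j + 1) + 1 := by positivity
    have hj0 : (0 : ℝ) < j + 1 := by positivity
    have : T * (d (j + 1) + 1) * (j + 1) - (a (j + 1) - b (j + 1)) * (j + 1)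
        = (T - ((a (j + 1) : ℝ) - b (j + 1)) / (d (j + 1) + 1)) * ((d (j + 1) + 1) * (j + 1)) := by
      field_simp
    rw [this, abs_mul, abs_of_pos (mul_pos hd0 hj0)]
    calc _ < 1 / ((j : ℝ) + 1) * ((d (j + 1) + 1) * (j + 1)) := by gcongr
      _ = _ := by field_simp
  have hA := ha.comp hs
  have hB := hb.comp hs
  have hD := hd.comp hs
  -- These are `f (j + 1) ∓ 1 / (j + 1)` over a common denominator. Truncating the lower one at 0 is
  -- harmless because `T > 0`, and the upper one is never truncated.
  refine ⟨fun j => a (j + 1) * (j + 1) - (b (j + 1) * (j + 1) + (d (j + 1) + 1)),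
    fun j => a (j + 1) * (j + 1) + (d (j + 1) + 1) - b (j + 1) * (j + 1),
    fun j => (d (j + 1) + 1) * (j + 1),
    Computable.nat_sub (Computable.nat_mul hA hs) (Computable.nat_add (Computable.nat_mul hB hs)
      (Computable.succ.comp hD)),
    Computable.nat_sub (Computable.nat_add (Computable.nat_mul hA hs) (Computable.succ.comp hD))
      (Computable.nat_mul hB hs),
    Computable.nat_mul (Computable.succ.comp hD) hs, fun j => by positivity, fun j => ?_,
    fun j => ?_, fun j => ?_⟩
  all_goals
    have k := abs_lt.1 (key j)
    have hd0 : (0 : ℝ) < d (j + 1) + 1 := by positivity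
    have hj0 : (0 : ℝ) < j + 1 := by positivity
    have hT0 : 0 < T * (d (j + 1) + 1) * (j + 1) := by positivity
    have hle : b (j + 1) * (j + 1) ≤ a (j + 1) * (j + 1) + (d (j + 1) + 1) := by
      have : (b (j + 1) * (j + 1) : ℝ) ≤ a (j + 1) * (j + 1) + (d (j + 1) + 1) := by nlinarith
      exact_mod_cast this
  · push_cast
    rw [div_le_iff₀ (by positivity)]
    rcases le_total (b (j + 1) * (j + 1) + (d (j + 1) + 1)) (a (j + 1) * (j + 1)) with h | h
    · rw [Nat.cast_sub h]; push_cast; nlinarith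
    · rw [Nat.sub_eq_zero_of_le h]; push_cast; nlinarith
  · push_cast
    rw [le_div_iff₀ (by positivity), Nat.cast_sub hle]
    push_cast; nlinarith
  · push_cast
    rw [div_add_div _ _ (by positivity) (by positivity),
      div_le_div_iff₀ (by positivity) (by positivity), Nat.cast_sub hle]
    have h3 : (a (j + 1) * (j + 1) : ℝ) - (b (j + 1) * (j + 1) + (d (j + 1) + 1))
        ≤ ((a (j + 1) * (j + 1) - (b (j + 1) * (j + 1) + (d (j + 1) + 1)) : ℕ) : ℝ) := by
      have := Nat.sub_le_iff_le_add'.1 (le_refl (a (j + 1) * (j + 1) -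
        (b (j + 1) * (j + 1) + (d (j + 1) + 1))))
      have h4 : ((a (j + 1) * (j + 1) : ℕ) : ℝ) ≤ ((b (j + 1) * (j + 1) + (d (j + 1) + 1) +
        (a (j + 1) * (j + 1) - (b (j + 1) * (j + 1) + (d (j + 1) + 1))) : ℕ) : ℝ) :=
        Nat.cast_le.2 this
      rw [Nat.cast_add] at h4
      push_cast at h4
      linarith
    have hp : (0 : ℝ) < (d (j + 1) + 1) * (j + 1) * (j + 1) := by positivity
    generalize ((a (j + 1) * (j + 1) - (b (j + 1) * (j + 1) + (d (j + 1) + 1)) : ℕ) : ℝ) = X at h3 ⊢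
    push_cast
    have : (a (j + 1) * (j + 1) + (d (j + 1) + 1) - b (j + 1) * (j + 1) : ℝ)
        ≤ X + 2 * (d (j + 1) + 1) := by linarith
    have := mul_le_mul_of_nonneg_right this hp.le
    nlinarith

/-- Computable dyadic approximations `lo j / 2 ^ j` and `hi j / 2 ^ j` of a real number from
below and from above. -/
structure DyadicBounds (β : ℝ) (lo hi : ℕ → ℕ) : Prop where
  computable_lo : Computable lo
  computable_hi : Computable hi
  lo_le : ∀ j, (lo j : ℝ) / 2 ^ j ≤ β
  le_hi : ∀ j, β ≤ (hi j : ℝ) / 2 ^ j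
  tendsto_lo : Tendsto (fun j => (lo j : ℝ) / 2 ^ j) atTop (𝓝 β)
  tendsto_hi : Tendsto (fun j => (hi j : ℝ) / 2 ^ j) atTop (𝓝 β)

theorem IsComputableReal.exists_dyadicBounds {T : ℝ} (hT : 0 < T) (h : IsComputableReal T) :
    ∃ lo hi, DyadicBounds ((2 : ℝ) ^ (-1 / T)) lo hi := by
  obtain ⟨A, A', B, cA, cA', cB, hB, hA, hA', hAA⟩ := h.exists_nat_bounds hT
  have hB0 : ∀ j, (0 : ℝ) < B j := fun j => by exact_mod_cast Nat.pos_of_ne_zero (hB j)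
  have h2 : Tendsto (fun j : ℕ => (2 : ℝ) / (j + 1)) atTop (𝓝 0) := by
    have := tendsto_one_div_add_atTop_nhds_zero_nat (𝕜 := ℝ) |>.const_mul 2
    simpa [div_eq_mul_inv] using this
  have tA : Tendsto (fun j => (A j : ℝ) / B j) atTop (𝓝 T) := by
    refine tendsto_of_tendsto_of_tendsto_of_le_of_le
      (by simpa using (tendsto_const_nhds (x := T)).sub h2) tendsto_const_nhds (fun j => ?_) hA
    have := hAA j; have := hA' j
    simp only; linarith
  have tA' : Tendsto (fun j => (A' j : ℝ) / B j) atTop (𝓝 T) := by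
    refine tendsto_of_tendsto_of_tendsto_of_le_of_le tendsto_const_nhds
      (by simpa using (tendsto_const_nhds (x := T)).add h2) hA' (fun j => ?_)
    have := hAA j; have := hA j
    simp only; linarith
  have hpow : Tendsto (fun j : ℕ => (1 : ℝ) / 2 ^ j) atTop (𝓝 0) := by
    have := tendsto_pow_atTop_nhds_zero_of_lt_one (r := (1 / 2 : ℝ)) (by norm_num) (by norm_num)
    simpa [one_div] using this
  have lim : ∀ X : ℕ → ℕ, Tendsto (fun j => (X j : ℝ) / B j) atTop (𝓝 T) →
      Tendsto (fun j => (2 : ℝ) ^ (-(B j : ℝ) / X j)) atTop (𝓝 ((2 : ℝ) ^ (-1 / T))) := by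
    intro X hX
    have e : ∀ j, -(B j : ℝ) / X j = -1 / ((X j : ℝ) / B j) := by
      intro j; rw [div_div_eq_mul_div]; ring
    simp only [e]
    exact tendsto_const_nhds.rpow (tendsto_const_nhds.div hX hT.ne') (Or.inl (by norm_num))
  have pos : ∀ {X b : ℕ}, b ≠ 0 → (0 : ℝ) < X / b → X ≠ 0 := by
    rintro X b hb hX rfl; simp at hX
  have pA' : ∀ j, A' j ≠ 0 := fun j => pos (hB j) (hT.trans_le (hA' j))
  have pA : ∀ᶠ j in atTop, A j ≠ 0 := (tA.eventually (lt_mem_nhds hT)).mono fun j hj => pos (hB j) hj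
  -- `2 ^ (-1 / T)` increases with `T`: the lower approximation of `T` is rounded down, the upper
  -- one rounded up by the added 1.
  refine ⟨fun j => dyadicRoot (A j) (B j) j, fun j => dyadicRoot (A' j) (B j) j + 1,
    computable_dyadicRoot cA cB Computable.id,
    Computable.succ.comp (computable_dyadicRoot cA' cB Computable.id), fun j => ?_, fun j => ?_,
    ?_, ?_⟩
  · by_cases h0 : A j = 0
    · rw [h0, dyadicRoot_zero_left (hB j)]; simp; positivity
    · refine (dyadicRoot_le h0).trans (Real.rpow_le_rpow_of_exponent_le (by norm_num) ?_)
      have hA0 : (0 : ℝ) < A j := by exact_mod_cast Nat.pos_of_ne_zero h0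
      have := hA j
      rw [div_le_iff₀ (hB0 j)] at this
      rw [div_le_div_iff₀ hA0 hT]; linarith
  · push_cast
    refine le_trans (Real.rpow_le_rpow_of_exponent_le (by norm_num) ?_)
      (le_dyadicRoot_add_one (pA' j))
    have hA0 : (0 : ℝ) < A' j := by exact_mod_cast Nat.pos_of_ne_zero (pA' j)
    have := hA' j
    rw [le_div_iff₀ (hB0 j)] at this
    rw [div_le_div_iff₀ hT hA0]; linarith
  · refine tendsto_of_tendsto_of_tendsto_of_le_of_le'
      (by simpa using (lim A tA).sub hpow) (lim A tA) ?_ ?_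
    · filter_upwards [pA] with j hj
      have := le_dyadicRoot_add_one (B := B j) (j := j) hj
      rw [add_div, one_div] at this; linarith
    · filter_upwards [pA] with j hj using dyadicRoot_le hj
  · refine tendsto_of_tendsto_of_tendsto_of_le_of_le
      (lim A' tA') (by simpa using (lim A' tA').add hpow) (fun j => ?_) fun j => ?_
    · push_cast; exact le_dyadicRoot_add_one (pA' j)
    · have := dyadicRoot_le (B := B j) (j := j) (pA' j)
      push_cast; rw [add_div, one_div]; linarith

/-- A decidable certificate, at precision `j`, that `N * logb β (stageSum c β K)` lies strictly
between `x - 1` and `x + 1`. -/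
def logCertificate (c : Code) (lo hi : ℕ → ℕ) (K N x j : ℕ) : Bool :=
  decide (hi j ^ (x + 1) * (2 ^ j) ^ (K * N) < stageNum c K (lo j) (2 ^ j) ^ N * (2 ^ j) ^ (x + 1))
  && decide (hi j * stageNum c K (hi j) (2 ^ j) ^ N * (2 ^ j) ^ x
      < lo j ^ x * (2 ^ j) ^ (K * N + 1))

theorem computable_logCertificate {α : Type*} [Primcodable α] (c : Code) {lo hi : ℕ → ℕ}
    (hlo : Computable lo) (hhi : Computable hi) {K N x j : α → ℕ} (hK : Computable K)
    (hN : Computable N) (hx : Computable x) (hj : Computable j) :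
    Computable fun a => logCertificate c lo hi (K a) (N a) (x a) (j a) := by
  have h2 : Computable fun a => 2 ^ j a := Computable.nat_pow (Computable.const 2) hj
  have hl := hlo.comp hj
  have hh := hhi.comp hj
  have hx1 := Computable.succ.comp hx
  have hKN := Computable.nat_mul hK hN
  exact Computable.bool_and
    (Computable.nat_lt
      (Computable.nat_mul (Computable.nat_pow hh hx1) (Computable.nat_pow h2 hKN))
      (Computable.nat_mul (Computable.nat_pow (computable_stageNum c hK hl h2) hN)
        (Computable.nat_pow h2 hx1)))
    (Computable.nat_lt
      (Computable.nat_mul (Computable.nat_mul hh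
        (Computable.nat_pow (computable_stageNum c hK hh h2) hN)) (Computable.nat_pow h2 hx))
      (Computable.nat_mul (Computable.nat_pow hl hx)
        (Computable.nat_pow h2 (Computable.succ.comp hKN))))

/-- The certificate is this pair of inequalities with denominators cleared. Each occurrence of `β`
in `β ^ (x + 1) < Z ^ N` and `β * Z ^ N < β ^ x` is replaced by the less favourable bound, so a
certificate is sound at every precision. -/
theorem logCertificate_iff {c : Code} {lo hi : ℕ → ℕ} {K N x j : ℕ} :
    logCertificate c lo hi K N x j = true ↔
      ((hi j : ℝ) / 2 ^ j) ^ (x + 1) < stageSum c ((lo j : ℝ) / 2 ^ j) K ^ N ∧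
      ((hi j : ℝ) / 2 ^ j) * stageSum c ((hi j : ℝ) / 2 ^ j) K ^ N < ((lo j : ℝ) / 2 ^ j) ^ x := by
  have e : ∀ u : ℕ, stageSum c ((u : ℝ) / 2 ^ j) K
      = (stageNum c K u (2 ^ j) : ℝ) / (2 ^ j) ^ K := by
    intro u
    have := stageSum_eq_stageNum_div c K u (2 ^ j) (by positivity)
    push_cast at this
    exact this
  have hV : (0 : ℝ) < 2 ^ j := by positivity
  rw [logCertificate, Bool.and_eq_true, decide_eq_true_iff, decide_eq_true_iff, e, e,
    div_pow, div_pow, div_pow, div_mul_div_comm, div_lt_div_iff₀ (by positivity) (by positivity),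
    div_pow, div_lt_div_iff₀ (by positivity) (by positivity),
    ← Nat.cast_lt (α := ℝ), ← Nat.cast_lt (α := ℝ)]
  push_cast
  simp only [← pow_mul, pow_succ ((2 : ℝ) ^ j) (K * N), mul_comm ((2 : ℝ) ^ j) _]
  simp only [mul_add, mul_one, mul_assoc]

theorem abs_sub_lt_of_logCertificate {c : Code} {β : ℝ} {lo hi : ℕ → ℕ} (h : DyadicBounds β lo hi)
    (h0 : 0 < β) (h1 : β < 1) {K N x j : ℕ} (hZ : 0 < stageSum c β K)
    (hc : logCertificate c lo hi K N x j = true) :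
    |(x : ℝ) - N * Real.logb β (stageSum c β K)| < 1 := by
  obtain ⟨ha, hb⟩ := logCertificate_iff.1 hc
  have hlo0 : (0 : ℝ) ≤ (lo j : ℝ) / 2 ^ j := by positivity
  have eZ : stageSum c β K ^ N = β ^ (N * Real.logb β (stageSum c β K)) := by
    rw [mul_comm, Real.rpow_mul h0.le, Real.rpow_logb h0 h1.ne hZ, Real.rpow_natCast]
  have ha' : β ^ (x + 1) < stageSum c β K ^ N := by
    calc β ^ (x + 1) ≤ ((hi j : ℝ) / 2 ^ j) ^ (x + 1) := by gcongr; exact h.le_hi j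
      _ < _ := ha
      _ ≤ _ := by
        refine pow_le_pow_left₀ ?_ (stageSum_le_stageSum hlo0 (h.lo_le j) K) N
        exact Finset.sum_nonneg fun i _ => by split_ifs <;> positivity
  have hb' : β * stageSum c β K ^ N < β ^ x := by
    calc β * stageSum c β K ^ N
        ≤ ((hi j : ℝ) / 2 ^ j) * stageSum c ((hi j : ℝ) / 2 ^ j) K ^ N := by
          gcongr
          · exact h.le_hi j
          · exact stageSum_le_stageSum h0.le (h.le_hi j) K
      _ < _ := hb
      _ ≤ _ := by gcongr; exact h.lo_le j
  rw [eZ, ← Real.rpow_natCast, Real.rpow_lt_rpow_left_iff_of_base_lt_one h0 h1] at ha'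
  rw [eZ, show ∀ y : ℝ, β * β ^ y = β ^ (1 + y) from fun y => by
      rw [Real.rpow_add h0, Real.rpow_one], ← Real.rpow_natCast,
    Real.rpow_lt_rpow_left_iff_of_base_lt_one h0 h1] at hb'
  push_cast at ha'
  rw [abs_lt]
  constructor <;> linarith

/-- The floor of the target lies strictly inside the window of width 2, so both inequalities are
strict at `β` and persist for close dyadic bounds; no equality between reals has to be decided. -/
theorem exists_logCertificate {c : Code} {β : ℝ} {lo hi : ℕ → ℕ} (h : DyadicBounds β lo hi)
    (h0 : 0 < β) (h1 : β < 1) {K : ℕ} (N : ℕ) (hZ : 0 < stageSum c β K)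
    (hZ1 : stageSum c β K ≤ 1) :
    ∃ x j, logCertificate c lo hi K N x j = true := by
  have eZ : stageSum c β K ^ N = β ^ (N * Real.logb β (stageSum c β K)) := by
    rw [mul_comm, Real.rpow_mul h0.le, Real.rpow_logb h0 h1.ne hZ, Real.rpow_natCast]
  have hF0 : 0 ≤ N * Real.logb β (stageSum c β K) :=
    mul_nonneg (Nat.cast_nonneg _) (Real.logb_nonneg_of_base_lt_one h0 h1 hZ hZ1)
  set y := N * Real.logb β (stageSum c β K) with hy
  have ha : β ^ (⌊y⌋₊ + 1) < stageSum c β K ^ N := by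
    rw [eZ, ← Real.rpow_natCast, Real.rpow_lt_rpow_left_iff_of_base_lt_one h0 h1]
    push_cast
    exact Nat.lt_floor_add_one y
  have hb : β * stageSum c β K ^ N < β ^ ⌊y⌋₊ := by
    have h3 : β ^ y ≤ β ^ ⌊y⌋₊ := by
      rw [← Real.rpow_natCast]
      exact Real.rpow_le_rpow_of_exponent_ge h0 h1.le (Nat.floor_le hF0)
    have h4 : 0 < β ^ y := Real.rpow_pos_of_pos h0 _
    rw [eZ]; nlinarith
  have t1 := ((continuous_stageSum c K).tendsto β).comp h.tendsto_lo
  have t2 := ((continuous_stageSum c K).tendsto β).comp h.tendsto_hi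
  have e1 := (h.tendsto_hi.pow (⌊y⌋₊ + 1)).eventually_lt (t1.pow N) ha
  have e2 := (h.tendsto_hi.mul (t2.pow N)).eventually_lt (h.tendsto_lo.pow ⌊y⌋₊) hb
  obtain ⟨j, hj1, hj2⟩ := (e1.and e2).exists
  exact ⟨_, j, logCertificate_iff.2 ⟨hj1, hj2⟩⟩

/-- The logarithms of the stage sums are uniformly computable to any precision. -/
theorem exists_computable_logb_stageSum {c : Code} {β : ℝ} {lo hi : ℕ → ℕ}
    (h : DyadicBounds β lo hi) (h0 : 0 < β) (h1 : β < 1) (k₀ : ℕ)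
    (hZ : ∀ k, 0 < stageSum c β (k₀ + k)) (hZ1 : ∀ k, stageSum c β (k₀ + k) ≤ 1) :
    ∃ G : ℕ → ℕ → ℕ, Computable₂ G ∧
      ∀ k n, |(G k n : ℝ) - 2 ^ n * Real.logb β (stageSum c β (k₀ + k))| < 1 := by
  let P : ℕ × ℕ → ℕ → Bool := fun a i =>
    logCertificate c lo hi (k₀ + a.1) (2 ^ a.2) i.unpair.1 i.unpair.2
  have cP : Computable₂ P := by
    have hu : Computable fun p : (ℕ × ℕ) × ℕ => p.2.unpair := Computable.unpair.comp Computable.snd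
    exact computable_logCertificate c h.computable_lo h.computable_hi
      (Computable.nat_add (Computable.const k₀) (Computable.fst.comp Computable.fst))
      (Computable.nat_pow (Computable.const 2) (Computable.snd.comp Computable.fst))
      (Computable.fst.comp hu) (Computable.snd.comp hu)
  have exP : ∀ a, ∃ i, P a i = true := by
    intro a
    obtain ⟨x, j, hxj⟩ := exists_logCertificate h h0 h1 (2 ^ a.2) (hZ a.1) (hZ1 a.1)
    exact ⟨Nat.pair x j, by simpa [P] using hxj⟩
  have cf : Computable fun a => Nat.find (exP a) := by
    refine (Partrec.rfind cP.partrec₂).of_eq_tot fun a => ?_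
    rw [Nat.mem_rfind]
    refine ⟨by simpa using (Nat.find_spec (exP a)).symm, fun {m} hm => ?_⟩
    simpa using (Bool.eq_false_iff.2 (Nat.find_min (exP a) hm)).symm
  refine ⟨fun k n => (Nat.find (exP (k, n))).unpair.1,
    (Computable.fst.comp (Computable.unpair.comp cf)).to₂, fun k n => ?_⟩
  have := abs_sub_lt_of_logCertificate h h0 h1 (hZ k) (Nat.find_spec (exP (k, n)))
  push_cast at this
  exact this

theorem programSize_le {U : List Bool →. List Bool} {p s : List Bool} (h : s ∈ U p) :
    programSize U s ≤ p.length := Nat.sInf_le ⟨p, h, rfl⟩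

/-! ### Self-delimiting descriptions -/

/-- Splits `1 ^ a 0 w` into `a` and `w`. -/
def splitUnary (p : List Bool) : Option (ℕ × List Bool) :=
  bif decide (p.idxOf false < p.length) then some (p.idxOf false, p.drop (p.idxOf false + 1))
  else none

theorem computable_splitUnary : Computable splitUnary := by
  have hi : Computable fun p : List Bool => p.idxOf false :=
    (Primrec.list_idxOf.comp (Primrec.const false) Primrec.id).to_comp
  exact Computable.cond (Computable.nat_lt hi Computable.list_length)
    (Computable.option_some.comp (hi.pair (Primrec.list_drop.to_comp.comp
      (Computable.succ.comp hi) Computable.id))) (Computable.const none)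

theorem splitUnary_replicate (a : ℕ) (w : List Bool) :
    splitUnary (List.replicate a true ++ false :: w) = some (a, w) := by
  have h : (List.replicate a true ++ false :: w).idxOf false = a := by
    rw [List.idxOf_append_of_notMem (by simp [List.mem_replicate])]
    simp
  simp [splitUnary, h, List.drop_append]

theorem splitUnary_append {p : List Bool} {a : ℕ} {w : List Bool} (h : splitUnary p = some (a, w))
    (t : List Bool) : splitUnary (p ++ t) = some (a, w ++ t) := by
  unfold splitUnary at h ⊢
  by_cases hp : p.idxOf false < p.length
  · simp only [hp, decide_true, cond_true, Option.some.injEq, Prod.mk.injEq] at h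
    have hm : false ∈ p := List.idxOf_lt_length_iff.1 hp
    have hlt : p.idxOf false < (p ++ t).length := by simp; omega
    rw [List.idxOf_append_of_mem hm]
    simp only [hlt, decide_true, cond_true, Option.some.injEq, Prod.mk.injEq]
    exact ⟨h.1, by rw [List.drop_append_of_le_length (by omega), h.2]⟩
  · simp [hp] at h

/-- Splits `1 ^ a 0 1 ^ b 0 w` into `Nat.pair a b` and `w`. -/
def splitHeader (p : List Bool) : Option (ℕ × List Bool) :=
  (splitUnary p).bind fun x => (splitUnary x.2).map fun y => (Nat.pair x.1 y.1, y.2)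

theorem computable_splitHeader : Computable splitHeader := by
  refine Computable.option_bind computable_splitUnary (Computable.option_map
    (computable_splitUnary.comp (Computable.snd.comp Computable.snd)) ?_)
  exact (Primrec₂.natPair.to_comp.comp
    (Computable.fst.comp (Computable.snd.comp Computable.fst))
    (Computable.fst.comp Computable.snd)).pair (Computable.snd.comp Computable.snd)

/-- A header is read off without looking past its end; prefix-freeness of the computers built from
it rests on this. -/
theorem splitHeader_append {p : List Bool} {N : ℕ} {w : List Bool}
    (h : splitHeader p = some (N, w)) (t : List Bool) :
    splitHeader (p ++ t) = some (N, w ++ t) := by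
  obtain ⟨⟨a, x⟩, hx, h⟩ := Option.bind_eq_some_iff.1 h
  obtain ⟨⟨b, y⟩, hy, h⟩ := Option.map_eq_some_iff.1 h
  simp only [Prod.mk.injEq] at h
  simp [splitHeader, splitUnary_append hx t, splitUnary_append hy t, h.1, h.2]

/-- Both components of an unpaired `N` are at most `√N`, so writing them in unary costs `O(√N)` bits
instead of `N`. -/
theorem unpair_fst_add_snd_le (N : ℕ) : N.unpair.1 + N.unpair.2 ≤ 2 * N.sqrt := by
  have h := Nat.max_sq_add_min_le_pair N.unpair.1 N.unpair.2
  rw [Nat.pair_unpair] at h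
  have h2 : max N.unpair.1 N.unpair.2 ≤ N.sqrt := Nat.le_sqrt'.2 (by omega)
  have := le_max_left N.unpair.1 N.unpair.2
  have := le_max_right N.unpair.1 N.unpair.2
  omega

/-- A number `N` together with a string of length `ℓ N` can be described with
`ℓ N + O(√N)` bits. -/
theorem IsOptimalComputer.exists_program_length_le {U : List Bool →. List Bool}
    (hU : IsOptimalComputer U) {f : ℕ → List Bool →. List Bool} (hf : Partrec₂ f) {ℓ : ℕ → ℕ}
    (hℓ : Computable ℓ) : ∃ c : ℕ, ∀ N w s, w.length = ℓ N → s ∈ f N w →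
      ∃ p, s ∈ U p ∧ p.length ≤ ℓ N + 2 * N.sqrt + c := by
  -- The payload must have exactly the length announced by the header, so it needs no delimiter of
  -- its own.
  let D : List Bool → Option (ℕ × List Bool) := fun p =>
    (splitHeader p).bind fun x => bif decide (x.2.length = ℓ x.1) then some x else none
  have hD : Computable D := by
    refine Computable.option_bind computable_splitHeader (Computable.cond (Computable.nat_eq
      (Computable.list_length.comp (Computable.snd.comp Computable.snd))
      (hℓ.comp (Computable.fst.comp Computable.snd)))
      (Computable.option_some.comp Computable.snd) (Computable.const none))
  have hD' : ∀ p x, D p = some x → splitHeader p = some x ∧ x.2.length = ℓ x.1 := by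
    intro p x h
    obtain ⟨y, hy, h⟩ := Option.bind_eq_some_iff.1 h
    by_cases hl : y.2.length = ℓ y.1
    · simp only [hl, decide_true, cond_true, Option.some.injEq] at h
      subst h; exact ⟨hy, hl⟩
    · simp [hl] at h
  let C : List Bool →. List Bool := fun p => (D p : Part (ℕ × List Bool)).bind fun x => f x.1 x.2
  have hdom : ∀ p ∈ C.Dom, ∃ x, D p = some x := by
    intro p hp
    obtain ⟨s, hs⟩ := Part.dom_iff_mem.1 hp
    obtain ⟨x, hx, -⟩ := Part.mem_bind_iff.1 hs
    exact ⟨x, by simpa using hx⟩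
  have hC : IsComputer C := by
    refine ⟨Partrec.bind (Computable.ofOption hD) ?_, ?_⟩
    · exact hf.comp (Computable.fst.comp Computable.snd) (Computable.snd.comp Computable.snd)
    · rintro p hp _ hq ⟨t, rfl⟩
      obtain ⟨⟨N, w⟩, hx⟩ := hdom p hp
      obtain ⟨y, hy⟩ := hdom _ hq
      have h1 := hD' _ _ hx
      have h2 := hD' _ _ hy
      rw [splitHeader_append h1.1 t] at h2
      obtain ⟨h2, h3⟩ := h2
      cases h2
      have h4 := h1.2
      simp only [List.length_append] at h3 h4
      have : t = [] := List.length_eq_zero_iff.1 (by omega)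
      simp [this]
  obtain ⟨sim, hsim⟩ := hU.simulates C hC
  -- The 2 counts the two separators `false` in the header.
  refine ⟨2 + sim, fun N w s hw hs => ?_⟩
  set p := List.replicate N.unpair.1 true ++ false :: (List.replicate N.unpair.2 true ++ false :: w)
  have hp : D p = some (N, w) := by
    simp [D, p, splitHeader, splitUnary_replicate, hw]
  obtain ⟨p', hp', hle⟩ := hsim p s (Part.mem_bind_iff.2 ⟨(N, w), by simp [hp], hs⟩)
  refine ⟨p', hp', hle.trans ?_⟩
  have := unpair_fst_add_snd_le N
  simp [p, hw]
  omega

theorem IsOptimalComputer.exists_programSize_le {U : List Bool →. List Bool}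
    (hU : IsOptimalComputer U) : ∃ c : ℕ, ∀ s : List Bool,
      ∃ p, s ∈ U p ∧ p.length ≤ s.length + 2 * s.length.sqrt + c := by
  obtain ⟨c, hc⟩ := hU.exists_program_length_le (f := fun _ w => Part.some w) (ℓ := id)
    (Computable.snd.partrec.to₂) Computable.id
  exact ⟨c, fun s => hc s.length s s rfl (Part.mem_some s)⟩

/-- Every string has a program, so the infimum in `programSize` is attained and is not the default
0. -/
theorem IsOptimalComputer.exists_shortest_program {U : List Bool →. List Bool}
    (hU : IsOptimalComputer U) (s : List Bool) : ∃ p, s ∈ U p ∧ p.length = programSize U s := by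
  obtain ⟨c, hc⟩ := hU.exists_programSize_le
  obtain ⟨p, hp, -⟩ := hc s
  exact Nat.sInf_mem (s := {k : ℕ | ∃ p : List Bool, s ∈ U p ∧ p.length = k}) ⟨_, p, hp, rfl⟩

/-! ### The Kraft inequality -/

/-- The first words of two equal concatenations are comparable as prefixes, hence equal, and can be
cancelled. The empty word could be inserted freely, so it is excluded. -/
theorem uniquelyDecodable_of_prefixFree {S : Set (List Bool)} (hne : [] ∉ S)
    (h : ∀ p ∈ S, ∀ q ∈ S, p <+: q → p = q) : InformationTheory.UniquelyDecodable S := by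
  intro l₁
  induction l₁ with
  | nil =>
    rintro (_ | ⟨b, l₂⟩) h₁ h₂ he
    · rfl
    · simp at he h₂
      exact absurd (he.1 ▸ h₂.1) hne
  | cons a l₁ ih =>
    rintro (_ | ⟨b, l₂⟩) h₁ h₂ he
    · simp at he h₁
      exact absurd (he.1 ▸ h₁.1) hne
    · have ha := h₁ a (by simp)
      have hb := h₂ b (by simp)
      rw [List.flatten_cons, List.flatten_cons] at he
      have hab : a = b := by
        rcases List.prefix_or_prefix_of_prefix (⟨_, he⟩ : a <+: b ++ l₂.flatten)
          (List.prefix_append b _) with h' | h'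
        · exact h a ha b hb h'
        · exact (h b hb a ha h').symm
      subst hab
      rw [ih l₂ (fun w hw => h₁ w (by simp [hw])) (fun w hw => h₂ w (by simp [hw]))
        (List.append_cancel_left he)]

theorem IsComputer.kraft {U : List Bool →. List Bool} (hU : IsComputer U) (S : Finset (List Bool))
    (hS : ∀ p ∈ S, p ∈ U.Dom) : ∑ p ∈ S, (1 / 2 : ℝ) ^ p.length ≤ 1 := by
  have hpf : ∀ p ∈ S, ∀ q ∈ S, p <+: q → p = q := fun p hp q hq =>
    hU.prefixFree p (hS p hp) q (hS q hq)
  by_cases hne : [] ∈ S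
  · have : S = {[]} := Finset.eq_singleton_iff_unique_mem.2
      ⟨hne, fun p hp => (hpf _ hne p hp List.nil_prefix).symm⟩
    simp [this]
  · have := InformationTheory.kraft_mcmillan_inequality (S := S)
      (uniquelyDecodable_of_prefixFree (by simpa using hne) (by simpa using hpf))
    simpa using this

/-! ### Limits of sums over exhausting finite sets -/

/-- Dominated convergence with `f` as its own bound. Applied both to the stages and to the arbitrary
enumeration, it shows that they share one limit. -/
theorem tendsto_sum_of_exhausting {α : Type*} {f : α → ℝ} (hf : Summable f) (h0 : ∀ a, 0 ≤ f a)
    {s : ℕ → Finset α} (hs : Monotone s) (he : ∀ a, f a ≠ 0 → ∃ k, a ∈ s k) :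
    Tendsto (fun k => ∑ a ∈ s k, f a) atTop (𝓝 (∑' a, f a)) := by
  classical
  have h1 : ∀ k, ∑ a ∈ s k, f a = ∑' a, if a ∈ s k then f a else 0 := fun k => by
    rw [tsum_eq_sum (s := s k) (fun a ha => by simp [ha])]
    exact Finset.sum_congr rfl fun a ha => by simp [ha]
  simp only [h1]
  refine tendsto_tsum_of_dominated_convergence hf (fun a => ?_) (Eventually.of_forall fun k a => ?_)
  · by_cases ha : f a = 0
    · simp [ha]
    · obtain ⟨k, hk⟩ := he a ha
      refine tendsto_const_nhds.congr' ?_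
      filter_upwards [eventually_ge_atTop k] with m hm
      simp [hs hm hk]
  · split_ifs
    · rw [Real.norm_of_nonneg (h0 a)]
    · simpa using h0 a

/-! ### The partition function and its computable stages -/

/-- The code `c` computes `U` on codes of binary strings. -/
structure IsCodeFor (c : Code) (U : List Bool →. List Bool) : Prop where
  eval_encode : ∀ p, c.eval (Encodable.encode p) = (U p).map Encodable.encode
  exists_encode : ∀ i, (c.eval i).Dom → ∃ p : List Bool, Encodable.encode p = i

theorem exists_isCodeFor {U : List Bool →. List Bool} (hU : Partrec U) : ∃ c, IsCodeFor c U := by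
  obtain ⟨c, hc⟩ := Code.exists_code.1 (Partrec.bind_decode₂_iff.1 hU)
  refine ⟨c, ⟨fun p => ?_, fun i hi => ?_⟩⟩
  · rw [hc]; simp
  · rw [hc] at hi
    obtain ⟨x, hx⟩ := Part.dom_iff_mem.1 hi
    obtain ⟨p, hp, -⟩ := Part.mem_bind_iff.1 hx
    exact ⟨p, Encodable.mem_decode₂.1 (by simpa using hp)⟩

/-- The programs that halt by stage `k`. -/
noncomputable def stageDomain (c : Code) (k : ℕ) : Finset (List Bool) :=
  ((Finset.range k).filter fun i => haltsBy c k i = true).preimage Encodable.encode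
    Encodable.encode_injective.injOn

theorem mem_stageDomain {c : Code} {k : ℕ} {p : List Bool} :
    p ∈ stageDomain c k ↔ haltsBy c k (Encodable.encode p) = true := by
  simp only [stageDomain, Finset.mem_preimage, Finset.mem_filter, Finset.mem_range,
    and_iff_right_iff_imp]
  exact lt_of_haltsBy

theorem monotone_stageDomain (c : Code) : Monotone (stageDomain c) := fun _ _ h _ hp =>
  mem_stageDomain.2 (haltsBy_mono h (mem_stageDomain.1 hp))

namespace IsCodeFor

variable {c : Code} {U : List Bool →. List Bool}

theorem mem_dom (hc : IsCodeFor c U) {k : ℕ} {p : List Bool} (hp : p ∈ stageDomain c k) :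
    p ∈ U.Dom := by
  have := dom_of_haltsBy (mem_stageDomain.1 hp)
  rw [hc.eval_encode] at this
  exact this

theorem exists_mem_stageDomain (hc : IsCodeFor c U) {p : List Bool} (hp : p ∈ U.Dom) :
    ∃ k, p ∈ stageDomain c k := by
  obtain ⟨k, hk⟩ := exists_haltsBy (c := c) (i := Encodable.encode p)
    (by rw [hc.eval_encode]; exact hp)
  exact ⟨k, mem_stageDomain.2 hk⟩

/-- Numbers that encode no string never halt, so summing over strings loses nothing. -/
theorem stageSum_eq (hc : IsCodeFor c U) (β : ℝ) (k : ℕ) :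
    stageSum c β k = ∑ p ∈ stageDomain c k, β ^ p.length := by
  rw [stageSum, ← Finset.sum_filter, stageDomain,
    ← Finset.sum_preimage (Encodable.encode : List Bool → ℕ) _ Encodable.encode_injective.injOn
      (fun i => β ^ codeLength i)]
  · simp only [codeLength_encode]
  · intro i hi hr
    obtain ⟨p, hp⟩ := hc.exists_encode i (dom_of_haltsBy (Finset.mem_filter.1 hi).2)
    exact absurd ⟨p, hp⟩ hr

end IsCodeFor

/-- The contribution of a string to the partition function. -/
noncomputable def programWeight (U : List Bool →. List Bool) (β : ℝ) : List Bool → ℝ :=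
  U.Dom.indicator fun p => β ^ p.length

/-- The partition function of `U` as a function of the weight `β` per bit. -/
noncomputable def partitionSum (U : List Bool →. List Bool) (β : ℝ) : ℝ :=
  ∑' p, programWeight U β p

section PartitionSum

variable {c : Code} {U : List Bool →. List Bool} {β : ℝ}

theorem programWeight_of_mem {p : List Bool} (hp : p ∈ U.Dom) :
    programWeight U β p = β ^ p.length := Set.indicator_of_mem hp _

theorem programWeight_nonneg (h0 : 0 ≤ β) (p : List Bool) : 0 ≤ programWeight U β p :=
  Set.indicator_nonneg (fun _ _ => by positivity) p

theorem sum_programWeight_le_one (hU : IsComputer U) (h0 : 0 ≤ β) (h1 : β ≤ 1 / 2)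
    (s : Finset (List Bool)) : ∑ p ∈ s, programWeight U β p ≤ 1 := by
  classical
  calc ∑ p ∈ s, programWeight U β p = ∑ p ∈ s with p ∈ U.Dom, β ^ p.length := by
        rw [Finset.sum_filter]; rfl
    _ ≤ ∑ p ∈ s with p ∈ U.Dom, (1 / 2 : ℝ) ^ p.length := by gcongr
    _ ≤ 1 := hU.kraft _ fun p hp => (Finset.mem_filter.1 hp).2

theorem summable_programWeight (hU : IsComputer U) (h0 : 0 ≤ β) (h1 : β ≤ 1 / 2) :
    Summable (programWeight U β) :=
  summable_of_sum_le (programWeight_nonneg h0) (sum_programWeight_le_one hU h0 h1)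

theorem partitionSum_le_one (hU : IsComputer U) (h0 : 0 ≤ β) (h1 : β ≤ 1 / 2) :
    partitionSum U β ≤ 1 :=
  (summable_programWeight hU h0 h1).tsum_le_of_sum_le (sum_programWeight_le_one hU h0 h1)

theorem sum_pow_le_partitionSum (hU : IsComputer U) (h0 : 0 ≤ β) (h1 : β ≤ 1 / 2)
    {s : Finset (List Bool)} (hs : ∀ p ∈ s, p ∈ U.Dom) :
    ∑ p ∈ s, β ^ p.length ≤ partitionSum U β := by
  rw [Finset.sum_congr rfl fun p hp => (programWeight_of_mem (hs p hp)).symm]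
  exact (summable_programWeight hU h0 h1).sum_le_tsum _ fun p _ => programWeight_nonneg h0 p

theorem monotone_stageSum (hc : IsCodeFor c U) (h0 : 0 ≤ β) : Monotone (stageSum c β) := by
  intro k l hkl
  rw [hc.stageSum_eq, hc.stageSum_eq]
  exact Finset.sum_le_sum_of_subset_of_nonneg (monotone_stageDomain c hkl) fun _ _ _ => by positivity

theorem stageSum_le_partitionSum (hU : IsComputer U) (hc : IsCodeFor c U) (h0 : 0 ≤ β)
    (h1 : β ≤ 1 / 2) (k : ℕ) : stageSum c β k ≤ partitionSum U β := by
  rw [hc.stageSum_eq]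
  exact sum_pow_le_partitionSum hU h0 h1 fun p hp => hc.mem_dom hp

/-- A program outside the stage must fit its weight into the remaining tail, which bounds its length
from below. -/
theorem stageSum_add_pow_le (hU : IsComputer U) (hc : IsCodeFor c U) (h0 : 0 ≤ β)
    (h1 : β ≤ 1 / 2) {k : ℕ} {p : List Bool} (hp : p ∈ U.Dom) (hpk : p ∉ stageDomain c k) :
    stageSum c β k + β ^ p.length ≤ partitionSum U β := by
  classical
  rw [hc.stageSum_eq, add_comm, ← Finset.sum_insert (f := fun p : List Bool => β ^ p.length) hpk]
  refine sum_pow_le_partitionSum hU h0 h1 fun x hx => ?_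
  rcases Finset.mem_insert.1 hx with rfl | hx
  · exact hp
  · exact hc.mem_dom hx

theorem tendsto_stageSum (hU : IsComputer U) (hc : IsCodeFor c U) (h0 : 0 ≤ β)
    (h1 : β ≤ 1 / 2) : Tendsto (stageSum c β) atTop (𝓝 (partitionSum U β)) := by
  have := tendsto_sum_of_exhausting (summable_programWeight hU h0 h1) (programWeight_nonneg h0)
    (monotone_stageDomain c) fun p hp =>
      hc.exists_mem_stageDomain (Set.mem_of_indicator_ne_zero hp)
  refine this.congr fun k => ?_
  rw [hc.stageSum_eq]
  exact Finset.sum_congr rfl fun p hp => programWeight_of_mem (hc.mem_dom hp)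

/-- Starting from `k₀` keeps `logb` away from 0, where its default value 0 could lie below the
limit. -/
theorem exists_stageSum_pos (hc : IsCodeFor c U) (h0 : 0 < β) {p : List Bool} (hp : p ∈ U.Dom) :
    ∃ k₀, ∀ k, 0 < stageSum c β (k₀ + k) := by
  obtain ⟨k₀, hk₀⟩ := hc.exists_mem_stageDomain hp
  refine ⟨k₀, fun k => lt_of_lt_of_le ?_ (monotone_stageSum hc h0.le (Nat.le_add_right k₀ k))⟩
  rw [hc.stageSum_eq]
  exact Finset.sum_pos (fun _ _ => by positivity) ⟨p, hk₀⟩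

end PartitionSum

/-! ### The partial sums along an enumeration -/

theorem two_rpow_neg_div (T : ℝ) (l : ℕ) :
    (2 : ℝ) ^ (-(l : ℝ) / T) = ((2 : ℝ) ^ (-1 / T)) ^ l := by
  rw [← Real.rpow_mul_natCast (by norm_num)]
  congr 1; ring

theorem neg_mul_logb_two {T : ℝ} (x : ℝ) :
    -T * Real.logb 2 x = Real.logb ((2 : ℝ) ^ (-1 / T)) x := by
  have h2 : Real.log 2 ≠ 0 := (Real.log_pos (by norm_num)).ne'
  rw [Real.logb, Real.logb, Real.log_rpow (by norm_num)]
  by_cases hT : T = 0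
  · simp [hT]
  · field_simp

theorem EnumeratesDomain.mem {q : ℕ → List Bool} {U : List Bool →. List Bool}
    (hq : EnumeratesDomain q U) (n : ℕ) : q n ∈ U.Dom := hq.2 ▸ Set.mem_range_self n

theorem two_rpow_neg_inv_mem {T : ℝ} (hT : 0 < T) (hT1 : T ≤ 1) :
    0 < (2 : ℝ) ^ (-1 / T) ∧ (2 : ℝ) ^ (-1 / T) ≤ 1 / 2 := by
  refine ⟨by positivity, ?_⟩
  calc (2 : ℝ) ^ (-1 / T) ≤ (2 : ℝ) ^ (-1 : ℝ) := by
        refine Real.rpow_le_rpow_of_exponent_le (by norm_num) ?_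
        rw [div_le_iff₀ hT]; linarith
    _ = 1 / 2 := by rw [Real.rpow_neg_one]; norm_num

theorem tendsto_partialPartitionFunction {U : List Bool →. List Bool} (hU : IsComputer U)
    {q : ℕ → List Bool} (hq : EnumeratesDomain q U) {T : ℝ} (hT : 0 < T) (hT1 : T ≤ 1) :
    Tendsto (partialPartitionFunction q T) atTop (𝓝 (partitionSum U ((2 : ℝ) ^ (-1 / T)))) := by
  obtain ⟨h0, h1⟩ := two_rpow_neg_inv_mem hT hT1
  have := tendsto_sum_of_exhausting (summable_programWeight hU h0.le h1)
    (programWeight_nonneg h0.le) (s := fun n => (Finset.range n).map ⟨q, hq.1⟩)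
    (fun m n h => Finset.map_subset_map.2 (Finset.range_mono h)) fun p hp => by
      have hp := Set.mem_of_indicator_ne_zero hp
      rw [← hq.2] at hp
      obtain ⟨n, rfl⟩ := hp
      exact ⟨n + 1, by simp⟩
  refine this.congr fun n => ?_
  rw [Finset.sum_map, partialPartitionFunction]
  refine Finset.sum_congr rfl fun i _ => ?_
  rw [two_rpow_neg_div]
  exact programWeight_of_mem (hq.mem i)

theorem partitionSum_pos {U : List Bool →. List Bool} (hU : IsComputer U) {β : ℝ} (h0 : 0 < β)
    (h1 : β ≤ 1 / 2) {p : List Bool} (hp : p ∈ U.Dom) : 0 < partitionSum U β := by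
  have := sum_pow_le_partitionSum hU h0.le h1 (s := {p}) (by simpa using hp)
  rw [Finset.sum_singleton] at this
  exact lt_of_lt_of_le (by positivity) this

theorem tendsto_partialFreeEnergy {U : List Bool →. List Bool} (hU : IsComputer U)
    {q : ℕ → List Bool} (hq : EnumeratesDomain q U) {T : ℝ} (hT : 0 < T) (hT1 : T ≤ 1) :
    Tendsto (partialFreeEnergy q T) atTop
      (𝓝 (Real.logb ((2 : ℝ) ^ (-1 / T)) (partitionSum U ((2 : ℝ) ^ (-1 / T))))) := by
  obtain ⟨h0, h1⟩ := two_rpow_neg_inv_mem hT hT1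
  have hZ := partitionSum_pos hU h0 h1 (hq.mem 0)
  rw [← neg_mul_logb_two]
  exact ((tendsto_partialPartitionFunction hU hq hT hT1).logb hZ.ne').const_mul _

/-! ### Binary prefixes -/

theorem binaryPrefix_eq_lowBits {x : ℝ} (hx : 0 ≤ x) (n : ℕ) :
    binaryPrefix (binaryExpansion x) n = lowBits n ⌊x * 2 ^ n⌋₊ := by
  refine List.map_congr_left fun i hi => ?_
  have hin := List.mem_range.1 hi
  have h1 : ⌊x * 2 ^ n⌋₊ / 2 ^ (n - 1 - i) = ⌊x * 2 ^ (i + 1)⌋₊ := by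
    rw [← Nat.floor_div_natCast]
    congr 1
    push_cast
    have : n = (i + 1) + (n - 1 - i) := by omega
    conv_lhs => rw [this, pow_add]
    have e : i + 1 + (n - 1 - i) - 1 - i = n - 1 - i := by omega
    rw [e]
    field_simp
  -- Removing the integer part changes the floor by an even number, so the digit is unaffected.
  have h2 : ⌊Int.fract x * 2 ^ (i + 1)⌋ = (⌊x * 2 ^ (i + 1)⌋₊ : ℤ) - 2 * (⌊x⌋ * 2 ^ i) := by
    rw [Int.natCast_floor_eq_floor (by positivity), ← Int.floor_sub_intCast]
    congr 1
    push_cast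
    rw [← Int.self_sub_floor]
    ring
  rw [binaryExpansion, h1, h2]
  congr 1
  apply propext
  omega

/-- The prefix determines the dyadic approximation of `x` once the fixed number `⌊x⌋₊` is built into
a computer. -/
theorem bitsValue_binaryPrefix {x : ℝ} (hx : 0 ≤ x) (n : ℕ) :
    bitsValue (binaryPrefix (binaryExpansion x) n) + ⌊x⌋₊ * 2 ^ n = ⌊x * 2 ^ n⌋₊ := by
  have h : ⌊x⌋₊ = ⌊x * 2 ^ n⌋₊ / 2 ^ n := by
    rw [← Nat.floor_div_natCast]
    push_cast
    rw [mul_div_cancel_right₀ _ (by positivity)]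
  rw [binaryPrefix_eq_lowBits hx, ← lowBits_mod,
    bitsValue_lowBits (Nat.mod_lt _ (by positivity)), h]
  exact Nat.mod_add_div' _ _

@[simp] theorem length_binaryPrefix (α : ℕ → Bool) (n : ℕ) : (binaryPrefix α n).length = n := by
  simp [binaryPrefix]

/-! ### Right-computability -/

theorem lt_add_one_div_of_abs_sub_lt {f : ℕ → ℝ} {G : ℕ → ℕ → ℕ}
    (hG : ∀ k n, |(G k n : ℝ) - 2 ^ n * f k| < 1) (k : ℕ) : f k < ((G k k : ℝ) + 1) / 2 ^ k := by
  have := abs_lt.1 (hG k k)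
  rw [lt_div_iff₀ (by positivity)]
  linarith

theorem tendsto_add_one_div_of_abs_sub_lt {F : ℝ} {f : ℕ → ℝ} (hf : Tendsto f atTop (𝓝 F))
    {G : ℕ → ℕ → ℕ} (hG : ∀ k n, |(G k n : ℝ) - 2 ^ n * f k| < 1) :
    Tendsto (fun k => ((G k k : ℝ) + 1) / 2 ^ k) atTop (𝓝 F) := by
  have hp : Tendsto (fun k : ℕ => (2 : ℝ) / 2 ^ k) atTop (𝓝 0) := by
    have := (tendsto_pow_atTop_nhds_zero_of_lt_one (r := (1 / 2 : ℝ)) (by norm_num)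
      (by norm_num)).const_mul 2
    simpa [div_eq_mul_inv] using this
  refine tendsto_of_tendsto_of_tendsto_of_le_of_le hf (by simpa using hf.add hp)
    (fun k => (lt_add_one_div_of_abs_sub_lt hG k).le) fun k => ?_
  have := abs_lt.1 (hG k k)
  rw [div_le_iff₀ (by positivity), add_mul, div_mul_cancel₀ _ (by positivity)]
  linarith

theorem isRightComputableReal_of_abs_sub_lt {F : ℝ} {f : ℕ → ℝ} (hF : ∀ k, F ≤ f k)
    (hf : Tendsto f atTop (𝓝 F)) {G : ℕ → ℕ → ℕ} (cG : Computable₂ G)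
    (hG : ∀ k n, |(G k n : ℝ) - 2 ^ n * f k| < 1) : IsRightComputableReal F := by
  have e : ∀ k, (((((G k k + 1 : ℕ) : ℚ) - (0 : ℕ)) / (((2 ^ k - 1 : ℕ) : ℚ) + 1) : ℚ) : ℝ)
      = ((G k k : ℝ) + 1) / 2 ^ k := by
    intro k
    rw [Nat.cast_sub Nat.one_le_two_pow]
    push_cast
    ring
  refine ⟨fun k => (((G k k + 1 : ℕ) : ℚ) - (0 : ℕ)) / (((2 ^ k - 1 : ℕ) : ℚ) + 1),
    ⟨fun k => G k k + 1, fun _ => 0, fun k => 2 ^ k - 1,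
      Computable.succ.comp (cG.comp Computable.id Computable.id), Computable.const 0,
      Computable.nat_sub (Computable.nat_pow (Computable.const 2) Computable.id)
        (Computable.const 1), fun k => rfl⟩, fun k _ => ?_, ?_⟩
  · rw [e]; exact (hF k).trans (lt_add_one_div_of_abs_sub_lt hG k).le
  · simp only [e]
    exact tendsto_add_one_div_of_abs_sub_lt hf hG

/-! ### Weak Chaitin randomness -/

theorem partrec_rfind_map {α σ : Type*} [Primcodable α] [Primcodable σ] {P : α → ℕ → Bool}
    (hP : Computable₂ P) {g : α → ℕ → σ} (hg : Computable₂ g) :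
    Partrec fun a => (Nat.rfind fun k => Part.some (P a k)).map (g a) :=
  Partrec.map (Partrec.rfind hP.partrec₂) hg

theorem exists_mem_rfind_map {σ : Type*} {P : ℕ → Bool} (h : ∃ k, P k = true) :
    ∃ k, P k = true ∧ ∀ g : ℕ → σ, g k ∈ (Nat.rfind fun k => Part.some (P k)).map g := by
  obtain ⟨k, hk, -⟩ := Nat.rfind_min' (p := P) h.choose_spec
  exact ⟨k, (Part.mem_some_iff.1 (Nat.rfind_spec hk)).symm, fun g => Part.mem_map g hk⟩

/-- A string longer than the code of every output produced by stage `k`. -/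
def freshString (c : Code) (k : ℕ) : List Bool :=
  lowBits (1 + ∑ i ∈ Finset.range k, (Code.evaln k c i).getD 0) 0

theorem computable_freshString {α : Type*} [Primcodable α] (c : Code) {k : α → ℕ}
    (hk : Computable k) : Computable fun a => freshString c (k a) := by
  refine computable_lowBits.comp (Computable.nat_add (Computable.const 1)
    (Computable.finset_sum_range hk ?_)) (Computable.const 0)
  exact Computable.option_getD ((computable_evaln c).comp (hk.comp Computable.fst) Computable.snd)
    (Computable.const 0)

/-- Outputs produced by the stage have codes bounded by the sum in `freshString`, while a code is at
least the length of its string. -/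
theorem notMem_stageDomain_of_freshString {c : Code} {U : List Bool →. List Bool}
    (hc : IsCodeFor c U) {k : ℕ} {p : List Bool} (hp : freshString c k ∈ U p) :
    p ∉ stageDomain c k := by
  intro hpk
  have hh := mem_stageDomain.1 hpk
  obtain ⟨v, hv⟩ := Option.isSome_iff_exists.1 hh
  have h1 : v ∈ c.eval (Encodable.encode p) := Code.evaln_sound hv
  rw [hc.eval_encode] at h1
  have h2 : v = Encodable.encode (freshString c k) := Part.mem_unique h1 (Part.mem_map _ hp)
  have h3 : (freshString c k).length ≤ v := h2 ▸ Encodable.length_le_encode _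
  have h4 : v ≤ ∑ i ∈ Finset.range k, (Code.evaln k c i).getD 0 := by
    have := Finset.single_le_sum (f := fun i => (Code.evaln k c i).getD 0)
      (fun _ _ => Nat.zero_le _) (Finset.mem_range.2 (lt_of_haltsBy hh))
    simpa [hv] using this
  rw [freshString, length_lowBits] at h3
  omega

theorem tendsto_logb_stageSum {U : List Bool →. List Bool} (hU : IsComputer U) {c : Code}
    (hc : IsCodeFor c U) {β : ℝ} (h0 : 0 ≤ β) (h1 : β ≤ 1 / 2) (hZ : 0 < partitionSum U β)
    (k₀ : ℕ) : Tendsto (fun k => Real.logb β (stageSum c β (k₀ + k))) atTop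
      (𝓝 (Real.logb β (partitionSum U β))) := by
  have := ((tendsto_stageSum hU hc h0 h1).comp (tendsto_add_atTop_nat k₀)).logb (b := β) hZ.ne'
  simpa [add_comm k₀] using this

theorem weaklyChaitinRandom_logb_partitionSum {U : List Bool →. List Bool}
    (hU : IsOptimalComputer U) {c : Code} (hc : IsCodeFor c U) {T : ℝ} (hT : 0 < T) (hT1 : T ≤ 1)
    {β : ℝ} (hβ : β = (2 : ℝ) ^ (-1 / T)) {k₀ : ℕ} (hpos : ∀ k, 0 < stageSum c β (k₀ + k))
    {G : ℕ → ℕ → ℕ} (cG : Computable₂ G)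
    (hG : ∀ k n, |(G k n : ℝ) - 2 ^ n * Real.logb β (stageSum c β (k₀ + k))| < 1) :
    WeaklyChaitinRandom U T (binaryExpansion (Real.logb β (partitionSum U β))) := by
  obtain ⟨h0, h1⟩ := two_rpow_neg_inv_mem hT hT1
  rw [← hβ] at h0 h1
  have hβ1 : β < 1 := by linarith
  have hZ : 0 < partitionSum U β :=
    (hpos 0).trans_le (stageSum_le_partitionSum hU.isComputer hc h0.le h1 _)
  have hZ1 := partitionSum_le_one hU.isComputer h0.le h1
  have hlim := tendsto_logb_stageSum hU.isComputer hc h0.le h1 hZ k₀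
  have hF0 : 0 ≤ Real.logb β (partitionSum U β) := Real.logb_nonneg_of_base_lt_one h0 hβ1 hZ hZ1
  set F := Real.logb β (partitionSum U β) with hF
  -- Compares the computable upper bound of `F_k` with `(⌊F * 2 ^ n⌋₊ + 1) / 2 ^ n`. The latter
  -- exceeds `F` strictly, so the search halts.
  let test : List Bool → ℕ → Bool := fun x k =>
    decide ((G k k + 1) * 2 ^ x.length < (bitsValue x + ⌊F⌋₊ * 2 ^ x.length + 1) * 2 ^ k)
  have ctest : Computable₂ test := by
    have c2 : Computable fun a : List Bool × ℕ => 2 ^ a.1.length :=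
      Computable.nat_pow (Computable.const 2) (Computable.list_length.comp Computable.fst)
    exact Computable.nat_lt
      (Computable.nat_mul (Computable.succ.comp (cG.comp Computable.snd Computable.snd)) c2)
      (Computable.nat_mul (Computable.succ.comp (Computable.nat_add
        (computable_bitsValue.comp Computable.fst) (Computable.nat_mul (Computable.const _) c2)))
        (Computable.nat_pow (Computable.const 2) Computable.snd))
  let ψ : List Bool →. List Bool := fun x =>
    (Nat.rfind fun k => Part.some (test x k)).map fun k => freshString c (k₀ + k)
  have cψ : Partrec ψ := partrec_rfind_map ctest (computable_freshString c
    (Computable.nat_add (Computable.const k₀) Computable.snd)).to₂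
  -- Running `U` first makes the new domain a subset of `Dom U`, hence prefix-free.
  have hC : IsComputer fun p => (U p).bind ψ := by
    refine ⟨Partrec.bind hU.isComputer.partrec (cψ.comp Computable.snd).to₂,
      fun p hp q hq hpq => hU.isComputer.prefixFree p hp.1 q hq.1 hpq⟩
  obtain ⟨sim, hsim⟩ := hU.simulates _ hC
  -- The term in `T` comes from the factor `1 / T` in the tail bound `2^{-n} / T`.
  refine ⟨sim - T * Real.logb 2 T, fun n _ => ?_⟩
  set x := binaryPrefix (binaryExpansion F) n with hx
  have htest : ∀ k, test x k = true ↔ ((G k k : ℝ) + 1) / 2 ^ k < (⌊F * 2 ^ n⌋₊ + 1) / 2 ^ n := by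
    intro k
    rw [div_lt_div_iff₀ (by positivity) (by positivity), decide_eq_true_iff, hx,
      length_binaryPrefix, bitsValue_binaryPrefix hF0, ← Nat.cast_lt (α := ℝ)]
    push_cast
    rfl
  have hex : ∃ k, test x k = true := by
    have hlt : F < (⌊F * 2 ^ n⌋₊ + 1) / 2 ^ n := by
      rw [lt_div_iff₀ (by positivity)]
      exact Nat.lt_floor_add_one _
    obtain ⟨k, hk⟩ := ((tendsto_add_one_div_of_abs_sub_lt hlim hG).eventually
      (gt_mem_nhds hlt)).exists
    exact ⟨k, (htest k).2 hk⟩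
  obtain ⟨k, hk, hmem⟩ := exists_mem_rfind_map (σ := List Bool) hex
  have hfk : Real.logb β (stageSum c β (k₀ + k)) < F + (2 ^ n)⁻¹ := by
    refine (lt_add_one_div_of_abs_sub_lt hG k).trans (((htest k).1 hk).trans_le ?_)
    rw [add_div, one_div]
    gcongr
    rw [div_le_iff₀ (by positivity)]
    exact Nat.floor_le (by positivity)
  obtain ⟨p, hp, hpl⟩ := hU.exists_shortest_program x
  obtain ⟨p', hp', hle⟩ := hsim p _ (Part.mem_bind_iff.2 ⟨x, hp, hmem fun k => freshString c (k₀ + k)⟩)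
  have hsum := stageSum_add_pow_le hU.isComputer hc h0.le h1 (Part.dom_iff_mem.2 ⟨_, hp'⟩)
    (notMem_stageDomain_of_freshString hc hp')
  have hZk : partitionSum U β * β ^ ((2 ^ n)⁻¹ : ℝ) ≤ stageSum c β (k₀ + k) := by
    have e1 : partitionSum U β = β ^ F := (Real.rpow_logb h0 hβ1.ne hZ).symm
    have e2 := Real.rpow_logb h0 hβ1.ne (hpos k)
    rw [← e2, e1, ← Real.rpow_add h0]
    exact Real.rpow_le_rpow_of_exponent_ge h0 hβ1.le hfk.le
  have hlog2 : Real.log 2 ≤ 1 := by linarith [Real.log_two_lt_d9]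
  have hexp : 1 - (2 ^ n : ℝ)⁻¹ / T ≤ β ^ ((2 ^ n)⁻¹ : ℝ) := by
    rw [hβ, ← Real.rpow_mul (by norm_num), Real.rpow_def_of_pos (by norm_num)]
    refine le_trans ?_ (Real.add_one_le_exp _)
    have h3 : 0 ≤ (2 ^ n : ℝ)⁻¹ / T := by positivity
    have : Real.log 2 * (-1 / T * (2 ^ n : ℝ)⁻¹) = -(Real.log 2 * ((2 ^ n : ℝ)⁻¹ / T)) := by ring
    rw [this]
    nlinarith
  -- The tail is at most `Z * (1 - β ^ (2^{-n}))`, and `Z ≤ 1`.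
  have hβp : β ^ p'.length ≤ (2 ^ n : ℝ)⁻¹ / T := by
    have h3 : β ^ ((2 ^ n)⁻¹ : ℝ) ≤ 1 := Real.rpow_le_one h0.le hβ1.le (by positivity)
    nlinarith
  have hlen : -(p'.length : ℝ) / T ≤ -(n : ℝ) - Real.logb 2 T := by
    have e1 : β ^ p'.length = (2 : ℝ) ^ (-(p'.length : ℝ) / T) := by rw [two_rpow_neg_div, hβ]
    have e2 : (2 ^ n : ℝ)⁻¹ / T = (2 : ℝ) ^ (-(n : ℝ) - Real.logb 2 T) := by
      rw [Real.rpow_sub (by norm_num), Real.rpow_logb (by norm_num) (by norm_num) hT,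
        Real.rpow_neg (by norm_num), Real.rpow_natCast]
    rw [e1, e2, Real.rpow_le_rpow_left_iff (by norm_num)] at hβp
    exact hβp
  rw [div_le_iff₀ hT] at hlen
  have hle' : (p'.length : ℝ) ≤ programSize U x + sim := by rw [← hpl]; exact_mod_cast hle
  linarith

/-! ### Compressibility -/

/-- A tail of the partition function at temperature `T` is controlled by the corresponding tail
of the halting probability. -/
theorem partitionSum_le_stageSum_add {U : List Bool →. List Bool} (hU : IsComputer U) {c : Code}
    (hc : IsCodeFor c U) {T : ℝ} (hT : 0 < T) (hT1 : T ≤ 1) {δ : ℝ} (hδ : 0 < δ) {k : ℕ}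
    (hk : partitionSum U (1 / 2) ≤ stageSum c (1 / 2) k + δ) :
    partitionSum U ((2 : ℝ) ^ (-1 / T)) ≤ stageSum c ((2 : ℝ) ^ (-1 / T)) k + δ ^ (1 / T) := by
  classical
  obtain ⟨h0, h1⟩ := two_rpow_neg_inv_mem hT hT1
  set β := (2 : ℝ) ^ (-1 / T) with hβ
  have hT' : 0 ≤ 1 / T - 1 := by
    have : 1 ≤ 1 / T := by rw [le_div_iff₀ hT]; linarith
    linarith
  refine (summable_programWeight hU h0.le h1).tsum_le_of_sum_le fun s => ?_
  let E : Finset (List Bool) := (s.filter fun p => p ∈ U.Dom) ∪ stageDomain c k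
  have hE : ∀ p ∈ E, p ∈ U.Dom := by
    intro p hp
    rcases Finset.mem_union.1 hp with hp | hp
    · exact (Finset.mem_filter.1 hp).2
    · exact hc.mem_dom hp
  have hsub : stageDomain c k ⊆ E := Finset.subset_union_right
  have e1 : ∑ p ∈ s, programWeight U β p ≤ ∑ p ∈ E, β ^ p.length := by
    calc ∑ p ∈ s, programWeight U β p = ∑ p ∈ s with p ∈ U.Dom, β ^ p.length := by
          rw [Finset.sum_filter]; rfl
      _ ≤ _ := Finset.sum_le_sum_of_subset_of_nonneg Finset.subset_union_left
          fun _ _ _ => by positivity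
  have htail : ∑ p ∈ E \ stageDomain c k, (1 / 2 : ℝ) ^ p.length ≤ δ := by
    have h2 := sum_pow_le_partitionSum hU (by norm_num) le_rfl hE
    rw [← Finset.sum_sdiff hsub, ← hc.stageSum_eq] at h2
    linarith
  -- Each tail program has `2^{-|p|} ≤ δ`; one factor of `(2^{-|p|}) ^ (1 / T)` is kept for
  -- summation and the rest, of exponent `1 / T - 1 ≥ 0`, is bounded by `δ`.
  have hterm : ∀ p ∈ E \ stageDomain c k,
      β ^ p.length ≤ (1 / 2 : ℝ) ^ p.length * δ ^ (1 / T - 1) := by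
    intro p hp
    have ha : (0 : ℝ) < (1 / 2) ^ p.length := by positivity
    have hle : (1 / 2 : ℝ) ^ p.length ≤ δ :=
      (Finset.single_le_sum (f := fun p : List Bool => (1 / 2 : ℝ) ^ p.length)
        (fun _ _ => by positivity) hp).trans htail
    have e2 : β ^ p.length = ((1 / 2 : ℝ) ^ p.length) ^ (1 + (1 / T - 1)) := by
      rw [hβ, ← two_rpow_neg_div, ← Real.rpow_natCast, ← Real.rpow_mul (by norm_num), one_div,
        Real.inv_rpow (by norm_num), ← Real.rpow_neg (by norm_num)]
      congr 1; ring
    rw [e2, Real.rpow_add ha, Real.rpow_one]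
    gcongr
  calc ∑ p ∈ s, programWeight U β p ≤ ∑ p ∈ E, β ^ p.length := e1
    _ = ∑ p ∈ E \ stageDomain c k, β ^ p.length + stageSum c β k := by
      rw [hc.stageSum_eq, Finset.sum_sdiff hsub]
    _ ≤ (∑ p ∈ E \ stageDomain c k, (1 / 2 : ℝ) ^ p.length) * δ ^ (1 / T - 1)
        + stageSum c β k := by
      rw [Finset.sum_mul]
      gcongr with p hp
      exact hterm p hp
    _ ≤ δ * δ ^ (1 / T - 1) + stageSum c β k := by gcongr
    _ = stageSum c β k + δ ^ (1 / T) := by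
      rw [add_comm, ← Real.rpow_one_add' hδ.le (by simp [hT.ne'])]
      congr 2; ring

/-- From `log (x / z) ≤ x / z - 1`. The fixed lower bound `z₀` makes the Lipschitz constant the same
for all stages. -/
theorem logb_stageSum_sub_le {T : ℝ} (hT : 0 < T) {x z z₀ ε : ℝ} (hz₀ : 0 < z₀) (hz : z₀ ≤ z)
    (hzx : z ≤ x) (hx : x ≤ z + ε) :
    Real.logb ((2 : ℝ) ^ (-1 / T)) z - Real.logb ((2 : ℝ) ^ (-1 / T)) x
      ≤ T / (Real.log 2 * z₀) * ε := by
  have hl : 0 < Real.log 2 := Real.log_pos (by norm_num)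
  have hz' : 0 < z := hz₀.trans_le hz
  have hx' : 0 < x := hz'.trans_le hzx
  have hε : 0 ≤ ε := by linarith
  have h1 : Real.log (x / z) ≤ ε / z₀ := by
    refine (Real.log_le_sub_one_of_pos (div_pos hx' hz')).trans ?_
    rw [div_sub_one hz'.ne']
    gcongr
    linarith
  rw [Real.log_div hx'.ne' hz'.ne'] at h1
  rw [← neg_mul_logb_two, ← neg_mul_logb_two, Real.logb, Real.logb]
  calc _ = T / Real.log 2 * (Real.log x - Real.log z) := by ring
    _ ≤ T / Real.log 2 * (ε / z₀) := by gcongr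
    _ = _ := by field_simp

/-- A computable upper approximation of `T * n`. -/
theorem IsComputableReal.exists_computable_mul_le {T : ℝ} (hT : 0 < T) (h : IsComputableReal T) :
    ∃ M : ℕ → ℕ, Computable M ∧ ∀ n : ℕ, T * n ≤ M n ∧ (M n : ℝ) ≤ T * n + 3 := by
  obtain ⟨A, A', B, -, cA', cB, hB, hA, hA', hAA⟩ := h.exists_nat_bounds hT
  -- The error `2 / (n + 1)` in `T` costs at most 2 after multiplication by `n`, and rounding costs
  -- 1 more.
  refine ⟨fun n => A' n * n / B n + 1, Computable.succ.comp (Computable.nat_div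
    (Computable.nat_mul cA' Computable.id) cB), fun n => ?_⟩
  have hB0 : (0 : ℝ) < B n := by exact_mod_cast Nat.pos_of_ne_zero (hB n)
  have hn : (0 : ℝ) ≤ n := Nat.cast_nonneg n
  constructor
  · have h1 : A' n * n < B n * (A' n * n / B n + 1) :=
      Nat.lt_mul_div_succ _ (Nat.pos_of_ne_zero (hB n))
    have h2 : (A' n : ℝ) * n ≤ B n * ((A' n * n / B n + 1 : ℕ) : ℝ) := by exact_mod_cast h1.le
    calc T * n ≤ A' n / B n * n := by gcongr; exact hA' n
      _ = A' n * n / B n := by ring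
      _ ≤ _ := by rw [div_le_iff₀ hB0]; linarith
  · have h1 : ((A' n * n / B n : ℕ) : ℝ) ≤ (A' n : ℝ) / B n * n := by
      refine Nat.cast_div_le.trans (le_of_eq ?_)
      push_cast; ring
    have h2 : (A' n : ℝ) / B n * n ≤ (T + 2 / (n + 1)) * n := by
      gcongr
      exact (hAA n).trans (by gcongr; exact hA n)
    have h3 : (2 : ℝ) / (n + 1) * n ≤ 2 := by
      rw [div_mul_eq_mul_div, div_le_iff₀ (by positivity)]; linarith
    push_cast
    linarith

theorem isLittleO_const_add_sqrt (a b : ℝ) :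
    (fun n : ℕ => a + 2 * √((n + 1) * b)) =o[atTop] fun n : ℕ => (n : ℝ) := by
  have hn : Tendsto (fun n : ℕ => (n : ℝ)) atTop atTop := tendsto_natCast_atTop_atTop
  have h1 : Tendsto (fun n : ℕ => (n : ℝ)⁻¹) atTop (𝓝 0) := tendsto_inv_atTop_zero.comp hn
  refine isLittleO_of_tendsto' ?_ ?_
  · filter_upwards [eventually_gt_atTop 0] with n hn h
    simp at h; omega
  · have h2 : Tendsto (fun n : ℕ => a * (n : ℝ)⁻¹ + 2 * √(((n : ℝ)⁻¹ + (n : ℝ)⁻¹ ^ 2) * b))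
        atTop (𝓝 (a * 0 + 2 * √((0 + 0 ^ 2) * b))) :=
      (h1.const_mul a).add (((h1.add (h1.pow 2)).mul_const b).sqrt.const_mul 2)
    simp only [mul_zero, zero_pow two_ne_zero, add_zero, zero_mul, Real.sqrt_zero] at h2
    refine h2.congr' ?_
    filter_upwards [eventually_gt_atTop 0] with n hn
    have hn' : (0 : ℝ) < n := by exact_mod_cast hn
    have : ((n : ℝ)⁻¹ + (n : ℝ)⁻¹ ^ 2) * b = (n + 1) * b / n ^ 2 := by field_simp
    rw [this, Real.sqrt_div' _ (by positivity), Real.sqrt_sq hn'.le]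
    field_simp

theorem compressible_logb_partitionSum {U : List Bool →. List Bool}
    (hU : IsOptimalComputer U) {c : Code} (hc : IsCodeFor c U) {T : ℝ} (hT : 0 < T) (hT1 : T ≤ 1)
    (hTc : IsComputableReal T) {β : ℝ} (hβ : β = (2 : ℝ) ^ (-1 / T)) {k₀ : ℕ}
    (hpos : ∀ k, 0 < stageSum c β (k₀ + k)) {G : ℕ → ℕ → ℕ} (cG : Computable₂ G)
    (hG : ∀ k n, |(G k n : ℝ) - 2 ^ n * Real.logb β (stageSum c β (k₀ + k))| < 1) :
    Compressible U T (binaryExpansion (Real.logb β (partitionSum U β))) := by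
  obtain ⟨h0, h1⟩ := two_rpow_neg_inv_mem hT hT1
  rw [← hβ] at h0 h1
  have hβ1 : β < 1 := by linarith
  have hU' := hU.isComputer
  have hZ : 0 < partitionSum U β := (hpos 0).trans_le (stageSum_le_partitionSum hU' hc h0.le h1 _)
  have hF0 : 0 ≤ Real.logb β (partitionSum U β) :=
    Real.logb_nonneg_of_base_lt_one h0 hβ1 hZ (partitionSum_le_one hU' h0.le h1)
  have hFk : ∀ k, Real.logb β (partitionSum U β) ≤ Real.logb β (stageSum c β (k₀ + k)) := fun k =>
    (Real.logb_le_logb_of_base_lt_one h0 hβ1 hZ (hpos k)).2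
      (stageSum_le_partitionSum hU' hc h0.le h1 _)
  set F := Real.logb β (partitionSum U β) with hF
  obtain ⟨M, cM, hM⟩ := hTc.exists_computable_mul_le hT
  set C' : ℝ := T / (Real.log 2 * stageSum c β k₀) with hC'
  -- Exceeds every correction `G k n - ⌊F * 2 ^ n⌋₊` that arises: `C'` from the tail, 1 from the
  -- error of `G`, 1 from the floor.
  set D : ℕ := ⌈C'⌉₊ + 2 with hD
  let test : List Bool → ℕ → Bool := fun w k =>
    decide (bitsValue w * 2 ^ (k₀ + k) < stageNum c (k₀ + k) 1 2 * 2 ^ w.length)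
  have ctest : Computable₂ test := by
    have ck : Computable fun a : List Bool × ℕ => k₀ + a.2 :=
      Computable.nat_add (Computable.const k₀) Computable.snd
    exact Computable.nat_lt
      (Computable.nat_mul (computable_bitsValue.comp Computable.fst)
        (Computable.nat_pow (Computable.const 2) ck))
      (Computable.nat_mul (computable_stageNum c ck (Computable.const 1) (Computable.const 2))
        (Computable.nat_pow (Computable.const 2) (Computable.list_length.comp Computable.fst)))
  have htest : ∀ w k, test w k = true ↔
      (bitsValue w : ℝ) / 2 ^ w.length < stageSum c (1 / 2) (k₀ + k) := by
    intro w k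
    have := stageSum_eq_stageNum_div c (k₀ + k) 1 2 (by norm_num)
    push_cast at this
    rw [this, div_lt_div_iff₀ (by positivity) (by positivity), decide_eq_true_iff,
      ← Nat.cast_lt (α := ℝ)]
    push_cast
    rfl
  -- The number `N = n * D + r` carries both the precision `n` and the correction `r < D`.
  let f : ℕ → List Bool →. List Bool := fun N w =>
    (Nat.rfind fun k => Part.some (test w k)).map fun k => lowBits (N / D) (G k (N / D) - N % D)
  have cf : Partrec₂ f := by
    have cN : Computable fun a : (ℕ × List Bool) × ℕ => a.1.1 :=
      Computable.fst.comp Computable.fst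
    have cn := Computable.nat_div cN (Computable.const D)
    exact partrec_rfind_map (P := fun (a : ℕ × List Bool) k => test a.2 k)
      (ctest.comp (Computable.snd.comp Computable.fst) Computable.snd).to₂
      (computable_lowBits.comp cn (Computable.nat_sub (cG.comp Computable.snd cn)
        (Computable.nat_mod cN (Computable.const D)))).to₂
  obtain ⟨b, hb⟩ := hU.exists_program_length_le cf
    (cM.comp (Computable.nat_div Computable.id (Computable.const D)))
  refine ⟨fun n => (3 + b) + 2 * √((n + 1) * D), isLittleO_const_add_sqrt _ _, fun n _ => ?_⟩
  have hΩ : 0 < partitionSum U (1 / 2) := by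
    obtain ⟨p, hp, -⟩ := hU.exists_shortest_program []
    exact partitionSum_pos hU' (by norm_num) le_rfl (Part.dom_iff_mem.2 ⟨_, hp⟩)
  have hΩ1 : partitionSum U (1 / 2) ≤ 1 := partitionSum_le_one hU' (by norm_num) le_rfl
  set Ω := partitionSum U (1 / 2) with hΩdef
  set m := M n with hm
  -- Ceiling minus one rather than floor: `u / 2 ^ m < Ω` is then strict, so the search halts, and
  -- `u` fits in `m` bits even if `Ω = 1`.
  obtain ⟨u, hu⟩ : ∃ u, ⌈Ω * 2 ^ m⌉₊ = u + 1 :=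
    Nat.exists_eq_succ_of_ne_zero (Nat.ceil_pos.2 (by positivity)).ne'
  have hu1 : (u : ℝ) / 2 ^ m < Ω := by
    rw [div_lt_iff₀ (by positivity)]
    exact Nat.lt_ceil.1 (by omega)
  have hu2 : Ω ≤ (u + 1) / 2 ^ m := by
    rw [le_div_iff₀ (by positivity)]
    have := Nat.le_ceil (Ω * 2 ^ m)
    rw [hu] at this
    exact_mod_cast this
  have hu3 : u < 2 ^ m := by
    have : (u : ℝ) / 2 ^ m < 1 := hu1.trans_le hΩ1
    rw [div_lt_one (by positivity)] at this
    exact_mod_cast this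
  set w := lowBits m u with hw
  have hex : ∃ k, test w k = true := by
    have hlim := (tendsto_stageSum hU' hc (by norm_num : (0 : ℝ) ≤ 1 / 2) le_rfl).comp
      (tendsto_add_atTop_nat k₀)
    obtain ⟨k, hk⟩ := (hlim.eventually (lt_mem_nhds hu1)).exists
    refine ⟨k, (htest w k).2 ?_⟩
    rw [hw, length_lowBits, bitsValue_lowBits hu3, add_comm k₀]
    exact hk
  obtain ⟨k, hk, hmem⟩ := exists_mem_rfind_map (σ := List Bool) hex
  rw [htest, hw, length_lowBits, bitsValue_lowBits hu3] at hk
  have hΩk : Ω ≤ stageSum c (1 / 2) (k₀ + k) + (2 ^ m)⁻¹ := by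
    rw [add_div, one_div] at hu2
    linarith
  have hZk := partitionSum_le_stageSum_add hU' hc hT hT1 (by positivity) hΩk
  rw [← hβ] at hZk
  have hε : ((2 ^ m : ℝ)⁻¹) ^ (1 / T) ≤ (2 ^ n)⁻¹ := by
    rw [← Real.rpow_natCast, ← Real.rpow_natCast, ← Real.rpow_neg (by norm_num),
      ← Real.rpow_neg (by norm_num), ← Real.rpow_mul (by norm_num)]
    refine Real.rpow_le_rpow_of_exponent_le (by norm_num) ?_
    rw [mul_one_div, div_le_iff₀ hT]
    linarith [(hM n).1]
  have hsub := logb_stageSum_sub_le hT (hpos 0)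
    (monotone_stageSum hc h0.le (Nat.add_le_add_left (Nat.zero_le k) k₀))
    (stageSum_le_partitionSum hU' hc h0.le h1 (k₀ + k)) 
    (by linarith : partitionSum U β ≤ stageSum c β (k₀ + k) + (2 ^ n)⁻¹)
  rw [← hβ, ← hF, add_zero, ← hC'] at hsub
  have hv := abs_lt.1 (hG k n)
  set X := ⌊F * 2 ^ n⌋₊ with hX
  have hp2 : (0 : ℝ) < 2 ^ n := by positivity
  have hX1 : (X : ℝ) ≤ F * 2 ^ n := Nat.floor_le (by positivity)
  have hX2 : F * 2 ^ n < X + 1 := Nat.lt_floor_add_one _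
  have hXv : X ≤ G k n := by
    have h3 := mul_le_mul_of_nonneg_left (hFk k) hp2.le
    have : (X : ℝ) < G k n + 1 := by linarith
    have : X < G k n + 1 := by exact_mod_cast this
    omega
  have hd : G k n - X < D := by
    have h3 : 2 ^ n * Real.logb β (stageSum c β (k₀ + k)) ≤ F * 2 ^ n + C' := by
      have := mul_le_mul_of_nonneg_left hsub hp2.le
      have e : 2 ^ n * (C' * (2 ^ n)⁻¹) = C' := by field_simp
      linarith
    have : (G k n : ℝ) < X + D := by
      rw [hD]; push_cast
      linarith [Nat.le_ceil C']
    have : G k n < X + D := by exact_mod_cast this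
    omega
  set N := n * D + (G k n - X) with hN
  have hD0 : 0 < D := by omega
  have hND : N / D = n := by
    rw [hN, mul_comm, Nat.mul_add_div hD0, Nat.div_eq_of_lt hd, add_zero]
  have hNm : N % D = G k n - X := by
    rw [hN, mul_comm, Nat.mul_add_mod, Nat.mod_eq_of_lt hd]
  have hout : binaryPrefix (binaryExpansion F) n ∈ f N w := by
    have h3 := hmem fun k => lowBits (N / D) (G k (N / D) - N % D)
    simp only [hND, hNm] at h3
    rw [Nat.sub_sub_self hXv, ← binaryPrefix_eq_lowBits hF0] at h3
    simpa only [f, hND, hNm] using h3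
  obtain ⟨p, hp, hle⟩ := hb N w _ (by simp only [hw, length_lowBits, id, hND, hm]) hout
  have hN' : (N : ℝ) ≤ (n + 1) * D := by
    have : N ≤ (n + 1) * D := by rw [hN, add_mul, one_mul]; omega
    exact_mod_cast this
  have hsq : (N.sqrt : ℝ) ≤ √((n + 1) * D) :=
    Real.nat_sqrt_le_real_sqrt.trans (Real.sqrt_le_sqrt hN')
  have hlen : (programSize U (binaryPrefix (binaryExpansion F) n) : ℝ)
      ≤ M n + 2 * N.sqrt + b := by
    have := (programSize_le hp).trans hle
    simp only [id, hND] at this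
    exact_mod_cast this
  linarith [(hM n).2]

/-! ### Divergence above temperature one -/

/-- Strings of length `a ^ 2` are used so that the overhead is exactly `2 * a + c`. Distinct strings
have distinct programs, so `2 ^ a ^ 2` separate terms are collected. -/
theorem tendsto_partialPartitionFunction_atTop {U : List Bool →. List Bool}
    (hU : IsOptimalComputer U) {q : ℕ → List Bool} (hq : EnumeratesDomain q U) {T : ℝ}
    (hT : 1 < T) : Tendsto (partialPartitionFunction q T) atTop atTop := by
  classical
  have hT0 : 0 < T := by linarith
  have hmono : Monotone (partialPartitionFunction q T) := fun m n h =>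
    Finset.sum_le_sum_of_subset_of_nonneg (Finset.range_mono h) fun _ _ _ => by positivity
  refine tendsto_atTop_atTop_of_monotone hmono fun B => ?_
  obtain ⟨c, hc⟩ := hU.exists_programSize_le
  choose P hPmem hPlen using hc
  have hidx : ∀ s, ∃ i, q i = P s := fun s => by
    have : P s ∈ Set.range q := by rw [hq.2]; exact Part.dom_iff_mem.2 ⟨s, hPmem s⟩
    exact this
  choose idx hidx using hidx
  have hinj : Function.Injective idx := fun s t h => by
    have : P s = P t := by rw [← hidx, ← hidx, h]
    exact Part.mem_unique (hPmem s) (this ▸ hPmem t)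
  -- The base-2 logarithm of `2 ^ a ^ 2` terms of weight `2 ^ (-(a ^ 2 + 2 * a + c) / T)`; its
  -- leading coefficient `1 - 1 / T` is positive.
  have hE : Tendsto (fun a : ℕ => (a : ℝ) * (a * (1 - 1 / T) - 2 / T) - c / T) atTop atTop := by
    have hn : Tendsto (fun n : ℕ => (n : ℝ)) atTop atTop := tendsto_natCast_atTop_atTop
    have hpos : 0 < 1 - 1 / T := by
      have : 1 / T < 1 := by rw [div_lt_one hT0]; exact hT
      linarith
    exact tendsto_atTop_add_const_right _ _
      (hn.atTop_mul_atTop₀ (tendsto_atTop_add_const_right _ _ (hn.atTop_mul_const hpos)))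
  have hE2 := (tendsto_rpow_atTop_of_base_gt_one 2 (by norm_num)).comp hE
  obtain ⟨a, ha⟩ := (hE2.eventually (eventually_ge_atTop B)).exists
  let S : Finset (List Bool) := (Finset.range (2 ^ a ^ 2)).image (lowBits (a ^ 2))
  have hScard : S.card = 2 ^ a ^ 2 := by
    rw [Finset.card_image_of_injOn, Finset.card_range]
    intro x hx y hy hxy
    rw [← bitsValue_lowBits (Finset.mem_range.1 hx), ← bitsValue_lowBits (Finset.mem_range.1 hy)]
    exact congrArg bitsValue hxy
  have hSlen : ∀ s ∈ S, s.length = a ^ 2 := fun s hs => by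
    obtain ⟨x, -, rfl⟩ := Finset.mem_image.1 hs
    simp
  obtain ⟨n, hn⟩ := (S.image idx).exists_nat_subset_range
  refine ⟨n, ha.trans ?_⟩
  have hterm : ∀ s ∈ S, (2 : ℝ) ^ (-((a : ℝ) ^ 2 + 2 * a + c) / T)
      ≤ (2 : ℝ) ^ (-((q (idx s)).length : ℝ) / T) := by
    intro s hs
    refine Real.rpow_le_rpow_of_exponent_le (by norm_num) ?_
    have h1 := hPlen s
    rw [hSlen s hs, Nat.sqrt_eq'] at h1
    have h2 : ((P s).length : ℝ) ≤ a ^ 2 + 2 * a + c := by exact_mod_cast h1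
    rw [hidx]
    gcongr
  calc (2 : ℝ) ^ ((a : ℝ) * (a * (1 - 1 / T) - 2 / T) - c / T)
      = (2 ^ a ^ 2 : ℝ) * (2 : ℝ) ^ (-((a : ℝ) ^ 2 + 2 * a + c) / T) := by
        rw [← Real.rpow_natCast 2 (a ^ 2), ← Real.rpow_add (by norm_num)]
        congr 1
        push_cast
        field_simp
        ring
    _ = ∑ s ∈ S, (2 : ℝ) ^ (-((a : ℝ) ^ 2 + 2 * a + c) / T) := by
        rw [Finset.sum_const, hScard, nsmul_eq_mul]
        push_cast
        rfl
    _ ≤ ∑ s ∈ S, (2 : ℝ) ^ (-((q (idx s)).length : ℝ) / T) := Finset.sum_le_sum hterm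
    _ = ∑ i ∈ S.image idx, (2 : ℝ) ^ (-((q i).length : ℝ) / T) :=
        (Finset.sum_image (f := fun i => (2 : ℝ) ^ (-((q i).length : ℝ) / T)) hinj.injOn).symm
    _ ≤ partialPartitionFunction q T n :=
        Finset.sum_le_sum_of_subset_of_nonneg hn fun _ _ _ => by positivity

theorem theorem4p2 (U : List Bool →. List Bool) (hU : IsOptimalComputer U)
    (q : ℕ → List Bool) (hq : EnumeratesDomain q U) (T : ℝ) :
    (0 < T → T ≤ 1 → IsComputableReal T →
      ∃ F : ℝ, Tendsto (partialFreeEnergy q T) atTop (𝓝 F) ∧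
        IsRightComputableReal F ∧
        WeaklyChaitinRandom U T (binaryExpansion F) ∧
        Compressible U T (binaryExpansion F)) ∧
    (1 < T → Tendsto (partialFreeEnergy q T) atTop atBot) := by
  refine ⟨fun hT hT1 hTc => ?_, fun hT => ?_⟩
  · have hU' := hU.isComputer
    obtain ⟨h0, h1⟩ := two_rpow_neg_inv_mem hT hT1
    obtain ⟨c, hc⟩ := exists_isCodeFor hU'.partrec
    obtain ⟨lo, hi, hb⟩ := hTc.exists_dyadicBounds hT
    have hlimF := tendsto_partialFreeEnergy hU' hq hT hT1
    obtain ⟨β, hβ⟩ : ∃ β, β = (2 : ℝ) ^ (-1 / T) := ⟨_, rfl⟩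
    rw [← hβ] at h0 h1 hb hlimF
    have hβ1 : β < 1 := by linarith
    obtain ⟨k₀, hpos⟩ := exists_stageSum_pos hc h0 (hq.mem 0)
    have hle := stageSum_le_partitionSum hU' hc h0.le h1
    obtain ⟨G, cG, hG⟩ := exists_computable_logb_stageSum hb h0 hβ1 k₀ hpos fun k =>
      (hle _).trans (partitionSum_le_one hU' h0.le h1)
    have hZ : 0 < partitionSum U β := (hpos 0).trans_le (hle _)
    refine ⟨_, hlimF, isRightComputableReal_of_abs_sub_lt (fun k => ?_)
      (tendsto_logb_stageSum hU' hc h0.le h1 hZ k₀) cG hG,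
      weaklyChaitinRandom_logb_partitionSum hU hc hT hT1 hβ hpos cG hG,
      compressible_logb_partitionSum hU hc hT hT1 hTc hβ hpos cG hG⟩
    exact (Real.logb_le_logb_of_base_lt_one h0 hβ1 hZ (hpos k)).2 (hle _)
  · exact ((Real.tendsto_logb_atTop (by norm_num : (1 : ℝ) < 2)).comp
      (tendsto_partialPartitionFunction_atTop hU hq hT)).const_mul_atTop_of_neg (by linarith)
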